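/- Let $G$ be a (finite-dimensional, real, smooth) Lie group with identity $e$, Lie algebra $\mathfrak g=T_eG$ and dual $\mathfrak g^*$, and let $L_g(x)=gx$. For $v\in T_gG$, $\xi\in\mathfrak g$ and $p\in T_g^*G$ write $g^{-1}\cdot v=T_gL_{g^{-1}}v\in\mathfrak g$, $g\cdot\xi=T_eL_g\xi\in T_gG$, $g^*\cdot p=p\circ T_eL_g\in\mathfrak g^*$, and let $\mu\mapsto g^{*-1}\cdot\mu\in T^*_gG$ be the inverse of $p\mapsto g^*\cdot p$. Let $H:T^*G\to\mathbb R$ be smooth, let $h(g,\mu)=H(g,g^{*-1}\cdot\mu)$ on $G\times\mathfrak g^*$, and let $T>0$, $g_0\in G$, $\mu_1\in\mathfrak g^*$. Let $(g,p):[0,T]\to T^*G$ be a smooth curve and let $\mu(t)=g(t)^*\cdot p(t)$. Put $$S[g,p]=\int_0^T\big(\langle p,\dot g\rangle-H(g,p)\big)\,dt,\qquad s[g,\mu]=\int_0^T\big(\langle\mu,g^{-1}\cdot\dot g\rangle-h(g,\mu)\big)\,dt .$$ A variation of a curve is a family of curves, smooth in $(\varepsilon,t)$ for $|\varepsilon|$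 small and $t\in[0,T]$, that equals the given curve at $\varepsilon=0$; $\delta$ denotes $\frac{d}{d\varepsilon}\big|_{\varepsilon=0}$ along it, and $\eta=g^{-1}\cdot\delta g$. Covectors over different base points are compared by left translation, so that for a variation $(g_\varepsilon,p_\varepsilon)$ in $T^*G$ we set $\delta p=g^{*-1}\cdot\frac{d}{d\varepsilon}\big|_{\varepsilon=0}(g_\varepsilon^*\cdot p_\varepsilon)\in T^*_gG$. The following are equivalent. (i) $g(0)=g_0$, $p(T)=g(T)^{*-1}\cdot\mu_1$, and $\delta S[g,p]=\langle p(T),\delta g(T)\rangle$ for all variations of $(g,p)$ in $T^*G$ with $\delta g(0)=0$ and $\delta p(T)=0$ (the Type II d'Alembert principle on $T^*G$). (ii) $g(0)=g_0$, $p(T)=g(T)^{*-1}\cdot\mu_1$, and Hamilton's equations $\dot g=D_pH(g,p)$, $\dot p=-D_gH(g,p)$ hold on $[0,T]$ in the canonical coordinates on $T^*G$ induced by every smooth chart of $G$. (iii) $g(0)=g_0$, $\mu(T)=\mu_1$, and $\delta s[g,\mu]=\langle\mu(T),\eta(T)\rangle$ for all variations of $(g,\mu)$ in $G\times\mathfrak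 g^*$ with $\eta(0)=0$ and $\delta\mu(T)=0$ (the left-trivialized Type II d'Alembert principle). (iv) $g(0)=g_0$, $\mu(T)=\mu_1$, and the Lie–Poisson equations $$\dot g=g\cdot D_\mu h(g,\mu),\qquad \dot\mu=-g^*\cdot D_gh(g,\mu)+\mathrm{ad}^*_{D_\mu h(g,\mu)}\mu$$ hold on $[0,T]$, where $D_gh(g,\mu)\in T_g^*G$ and $D_\mu h(g,\mu)\in\mathfrak g^{**}=\mathfrak g$ are the partial derivatives of $h$ and $\langle\mathrm{ad}^*_\xi\mu,\eta\rangle=\langle\mu,[\xi,\eta]\rangle$. -/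

import Mathlib

open Set Bundle
open scoped Manifold ContDiff Topology

noncomputable section

namespace TypeII

/-! ### Linear duality -/

section Duality

variable {V : Type*} [NormedAddCommGroup V] [NormedSpace ℝ V] [FiniteDimensional ℝ V]

theorem exists_bidual_rep (Φ : (V →L[ℝ] ℝ) →L[ℝ] ℝ) :
    ∃ v : V, ∀ α : V →L[ℝ] ℝ, α v = Φ α := by
  let b := Module.finBasis ℝ V
  let c : Fin (Module.finrank ℝ V) → (V →L[ℝ] ℝ) := fun i => (b.coord i).toContinuousLinearMap
  refine ⟨∑ i, Φ (c i) • b i, fun α => ?_⟩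
  have h : α = ∑ i, α (b i) • c i := by
    ext v
    have hv := congrArg α (b.sum_repr v)
    simp only [map_sum, map_smul, smul_eq_mul] at hv
    simp only [c, sum_apply, smul_apply, smul_eq_mul,
      LinearMap.coe_toContinuousLinearMap', Module.Basis.coord_apply]
    rw [← hv]
    exact Finset.sum_congr rfl fun i _ => mul_comm _ _
  conv_rhs => rw [h]
  simp only [map_sum, map_smul, smul_eq_mul]
  exact Finset.sum_congr rfl fun i _ => mul_comm _ _

/-- The canonical identification `V** ≅ V` of a finite-dimensional space with its bidual: the
vector `v` with `⟨α, v⟩ = Φ α` for all covectors `α`. -/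
def ofBidual (Φ : (V →L[ℝ] ℝ) →L[ℝ] ℝ) : V :=
  Classical.choose (exists_bidual_rep Φ)

theorem apply_ofBidual (Φ : (V →L[ℝ] ℝ) →L[ℝ] ℝ) (α : V →L[ℝ] ℝ) : α (ofBidual Φ) = Φ α :=
  Classical.choose_spec (exists_bidual_rep Φ) α

end Duality

/-! ### Lie groups: the cotangent bundle and left trivialization -/

section LieGroup

variable (E : Type*) [NormedAddCommGroup E] [NormedSpace ℝ E]
  (G : Type*) [TopologicalSpace G] [ChartedSpace E G]

/-- The cotangent bundle `T*G`, with fibre `(T_gG)*` over `g`, as a smooth vector bundle. -/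
abbrev CotangentBundle : Type _ :=
  TotalSpace (E →L[ℝ] ℝ) (fun g : G => TangentSpace 𝓘(ℝ, E) g →L[ℝ] Trivial G ℝ g)

/-- The dual `𝔤*` of the Lie algebra `𝔤 = T_eG`. The tangent space `T_eG` is by definition a copy
of the model space `E`; spelling it `E` provides the norm of `𝔤*`. -/
abbrev LieDual [One G] : Type _ := E →L[ℝ] ℝ

variable {E G} [Group G]

/-- The left translation `ξ ↦ g · ξ`, i.e. `T_eL_g : 𝔤 → T_gG`. -/
def translate (g : G) : GroupLieAlgebra 𝓘(ℝ, E) G →L[ℝ] TangentSpace 𝓘(ℝ, E) g :=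
  mfderiv 𝓘(ℝ, E) 𝓘(ℝ, E) (fun x : G => g * x) 1

/-- The left translation `v ↦ g⁻¹ · v`, i.e. `T_gL_{g⁻¹} : T_gG → 𝔤`. -/
def translateInv (g : G) : TangentSpace 𝓘(ℝ, E) g →L[ℝ] GroupLieAlgebra 𝓘(ℝ, E) G :=
  mfderiv 𝓘(ℝ, E) 𝓘(ℝ, E) (fun x : G => g⁻¹ * x) g

/-- `p ↦ g* · p = T*_eL_g p`, from `T*_gG` to `𝔤*`. -/
def cotranslate (g : G) (p : TangentSpace 𝓘(ℝ, E) g →L[ℝ] ℝ) : LieDual E G :=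
  p.comp (translate g)

/-- `μ ↦ g*⁻¹ · μ`, from `𝔤*` to `T*_gG`. -/
def cotranslateInv (g : G) (μ : LieDual E G) : TangentSpace 𝓘(ℝ, E) g →L[ℝ] ℝ :=
  ContinuousLinearMap.comp (M₂ := GroupLieAlgebra 𝓘(ℝ, E) G) μ (translateInv g)

/-- The momentum component `μ = g* · p` of the left trivialization `T*G ≅ G × 𝔤*`. -/
def momentum (q : CotangentBundle E G) : LieDual E G :=
  cotranslate q.1 q.2

/-- The left-trivialized Hamiltonian `h(g, μ) = H(g, g*⁻¹ · μ)`. -/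
def trivializedHamiltonian (H : CotangentBundle E G → ℝ) (g : G) (μ : LieDual E G) : ℝ :=
  H ⟨g, cotranslateInv g μ⟩

/-- The velocity `ġ(t)` of a curve on the time interval `[0, T]` (one-sided at the end points). -/
def velocity (T : ℝ) (g : ℝ → G) (t : ℝ) : TangentSpace 𝓘(ℝ, E) (g t) :=
  mfderivWithin 𝓘(ℝ, ℝ) 𝓘(ℝ, E) g (Icc 0 T) t (1 : ℝ)

/-- The variation `δg(t) = d/dε g_ε(t)` at `ε = 0` of a family of curves `g_ε`. -/
def positionVariation (g : ℝ → ℝ → G) (t : ℝ) : TangentSpace 𝓘(ℝ, E) (g 0 t) :=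
  mfderiv 𝓘(ℝ, ℝ) 𝓘(ℝ, E) (fun ε => g ε t) 0 (1 : ℝ)

/-! ### The variational principle on `T*G` -/

/-- The action `S[g, p] = ∫₀ᵀ (⟨p, ġ⟩ - H(g, p)) dt` of a curve in `T*G`. -/
def action (H : CotangentBundle E G → ℝ) (T : ℝ) (γ : ℝ → CotangentBundle E G) : ℝ :=
  ∫ t in (0 : ℝ)..T, ((γ t).2 (velocity T (fun s => (γ s).1) t) - H (γ t))

/-- The variation `δp(t) ∈ T*_{g(t)}G` of the momentum along a family of curves in `T*G`. Covectors
over the different base points `g_ε(t)` are compared by left translation, so that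
`δp = g*⁻¹ · d/dε (g_ε* · p_ε)` at `ε = 0`. -/
def momentumVariation (Γ : ℝ → ℝ → CotangentBundle E G) (t : ℝ) :
    TangentSpace 𝓘(ℝ, E) (Γ 0 t).1 →L[ℝ] ℝ :=
  cotranslateInv (Γ 0 t).1 (deriv (fun ε => momentum (Γ ε t)) 0)

variable [FiniteDimensional ℝ E] [LieGroup 𝓘(ℝ, E) ∞ G]

/-- `Γ = (g_ε, p_ε)` is a smooth variation of the curve `γ = (g, p)` on `[0, T]`: it is defined and
jointly smooth for `ε` near `0` and `t ∈ [0, T]`, and it is `γ` at `ε = 0`. -/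
def IsVariation (T : ℝ) (γ : ℝ → CotangentBundle E G) (Γ : ℝ → ℝ → CotangentBundle E G) : Prop :=
  (∃ r > 0, ContMDiffOn 𝓘(ℝ, ℝ × ℝ) (𝓘(ℝ, E).prod 𝓘(ℝ, E →L[ℝ] ℝ)) ∞
    (fun x : ℝ × ℝ => Γ x.1 x.2) (Ioo (-r) r ×ˢ Icc 0 T)) ∧
  ∀ t ∈ Icc 0 T, Γ 0 t = γ t

/-- The Type II d'Alembert principle on `T*G`: the curve satisfies `g(0) = g₀` and
`p(T) = g(T)*⁻¹ · μ₁`, and `δS[g, p] = ⟨p(T), δg(T)⟩` for all variations with `δg(0) = 0` and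
`δp(T) = 0`. -/
def DAlembertPrinciple (H : CotangentBundle E G → ℝ) (T : ℝ) (g₀ : G) (μ₁ : LieDual E G)
    (γ : ℝ → CotangentBundle E G) : Prop :=
  (γ 0).1 = g₀ ∧ (γ T).2 = cotranslateInv (γ T).1 μ₁ ∧
  ∀ Γ : ℝ → ℝ → CotangentBundle E G, IsVariation T γ Γ →
    positionVariation (E := E) (fun ε t => (Γ ε t).1) 0 = 0 → momentumVariation Γ T = 0 →
    HasDerivAt (fun ε => action H T (Γ ε))
      ((Γ 0 T).2 (positionVariation (fun ε t => (Γ ε t).1) T)) 0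

/-! ### Hamilton's equations in canonical coordinates -/

/-- The point of `T*G` with canonical coordinates `(x, a) ∈ E × E*` in the chart `φ` of `G`: the
covector `a ∘ T_gφ` at `g = φ⁻¹(x)`. -/
def ofCanonical (φ : OpenPartialHomeomorph G E) (x : E) (a : E →L[ℝ] ℝ) : CotangentBundle E G :=
  ⟨φ.symm x, a.comp (mfderiv 𝓘(ℝ, E) 𝓘(ℝ, E) φ (φ.symm x))⟩

/-- The canonical momentum coordinate `a = p ∘ (T_gφ)⁻¹` of the covector `(g, p)` in the chart
`φ`. -/
def canonicalMomentum (φ : OpenPartialHomeomorph G E) (q : CotangentBundle E G) : E →L[ℝ] ℝ :=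
  ContinuousLinearMap.comp (M₂ := TangentSpace 𝓘(ℝ, E) q.1) q.2
    (mfderiv 𝓘(ℝ, E) 𝓘(ℝ, E) φ q.1).inverse

/-- The derivative `D_pH ∈ E** = E` in canonical coordinates. -/
def canonicalDp (H : CotangentBundle E G → ℝ) (φ : OpenPartialHomeomorph G E) (x : E)
    (a : E →L[ℝ] ℝ) : E :=
  ofBidual (fderiv ℝ (fun b : E →L[ℝ] ℝ => H (ofCanonical φ x b)) a)

/-- The derivative `D_gH ∈ E*` in canonical coordinates. -/
def canonicalDg (H : CotangentBundle E G → ℝ) (φ : OpenPartialHomeomorph G E) (x : E)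
    (a : E →L[ℝ] ℝ) : E →L[ℝ] ℝ :=
  fderiv ℝ (fun y : E => H (ofCanonical φ y a)) x

/-- Hamilton's equations `ġ = D_pH`, `ṗ = -D_gH` on `[0, T]` in the canonical coordinates on `T*G`
of every smooth chart of `G`, with `g(0) = g₀` and `p(T) = g(T)*⁻¹ · μ₁`. -/
def HamiltonEquations (H : CotangentBundle E G → ℝ) (T : ℝ) (g₀ : G) (μ₁ : LieDual E G)
    (γ : ℝ → CotangentBundle E G) : Prop :=
  (∀ φ ∈ IsManifold.maximalAtlas 𝓘(ℝ, E) ∞ G, ∀ t ∈ Icc 0 T, (γ t).1 ∈ φ.source →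
    HasDerivWithinAt (fun s => φ (γ s).1)
      (canonicalDp H φ (φ (γ t).1) (canonicalMomentum φ (γ t))) (Icc 0 T) t ∧
    HasDerivWithinAt (fun s => canonicalMomentum φ (γ s))
      (-canonicalDg H φ (φ (γ t).1) (canonicalMomentum φ (γ t))) (Icc 0 T) t) ∧
  (γ 0).1 = g₀ ∧ (γ T).2 = cotranslateInv (γ T).1 μ₁

/-! ### The left-trivialized variational principle on `G × 𝔤*` -/

/-- The left-trivialized action `s[g, μ] = ∫₀ᵀ (⟨μ, g⁻¹ · ġ⟩ - h(g, μ)) dt`. -/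
def trivializedAction (h : G → LieDual E G → ℝ) (T : ℝ) (g : ℝ → G) (μ : ℝ → LieDual E G) : ℝ :=
  ∫ t in (0 : ℝ)..T, (μ t (translateInv (g t) (velocity T g t)) - h (g t) (μ t))

/-- The left-trivialized variation `η = g⁻¹ · δg`. -/
def trivializedVariation (g : ℝ → ℝ → G) (t : ℝ) : GroupLieAlgebra 𝓘(ℝ, E) G :=
  translateInv (g 0 t) (positionVariation g t)

/-- `(g_ε, μ_ε)` is a smooth variation of the curve `(g, μ)` in `G × 𝔤*` on `[0, T]`. -/
def IsTrivializedVariation (T : ℝ) (g : ℝ → G) (μ : ℝ → LieDual E G) (gv : ℝ → ℝ → G)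
    (μv : ℝ → ℝ → LieDual E G) : Prop :=
  (∃ r > 0, ContMDiffOn 𝓘(ℝ, ℝ × ℝ) (𝓘(ℝ, E).prod 𝓘(ℝ, LieDual E G)) ∞
    (fun x : ℝ × ℝ => (gv x.1 x.2, μv x.1 x.2)) (Ioo (-r) r ×ˢ Icc 0 T)) ∧
  ∀ t ∈ Icc 0 T, gv 0 t = g t ∧ μv 0 t = μ t

/-- The Type II d'Alembert principle on `G × 𝔤*`: the curve satisfies `g(0) = g₀` and
`μ(T) = μ₁`, and `δs[g, μ] = ⟨μ(T), η(T)⟩` for all variations with `η(0) = 0` and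
`δμ(T) = 0`. -/
def TrivializedDAlembertPrinciple (h : G → LieDual E G → ℝ) (T : ℝ) (g₀ : G) (μ₁ : LieDual E G)
    (g : ℝ → G) (μ : ℝ → LieDual E G) : Prop :=
  g 0 = g₀ ∧ μ T = μ₁ ∧
  ∀ (gv : ℝ → ℝ → G) (μv : ℝ → ℝ → LieDual E G), IsTrivializedVariation T g μ gv μv →
    trivializedVariation (E := E) gv 0 = 0 → deriv (fun ε => μv ε T) 0 = 0 →
    HasDerivAt (fun ε => trivializedAction h T (gv ε) (μv ε))
      (μ T (trivializedVariation gv T)) 0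

/-! ### The Lie–Poisson equations -/

/-- `ad_ξ : 𝔤 → 𝔤`, `ad_ξ η = [ξ, η]`. -/
def adjointMap (ξ : GroupLieAlgebra 𝓘(ℝ, E) G) : E →L[ℝ] E :=
  haveI : LieGroup 𝓘(ℝ, E) (minSmoothness ℝ 3) G := by
    rw [minSmoothness_of_isRCLikeNormedField]; infer_instance
  LinearMap.toContinuousLinearMap (E := E)
    (LieAlgebra.ad ℝ (GroupLieAlgebra 𝓘(ℝ, E) G) ξ)

theorem adjointMap_apply (ξ η : GroupLieAlgebra 𝓘(ℝ, E) G) : adjointMap ξ η = ⁅ξ, η⁆ := rfl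

/-- `ad*_ξ μ`, the covector `η ↦ ⟨μ, ad_ξ η⟩`. -/
def coadjoint (ξ : GroupLieAlgebra 𝓘(ℝ, E) G) (μ : LieDual E G) : LieDual E G :=
  μ.comp (adjointMap ξ)

/-- The derivative `D_μh(g, μ) ∈ 𝔤** = 𝔤`. -/
def trivializedDμ (h : G → LieDual E G → ℝ) (g : G) (μ : LieDual E G) :
    GroupLieAlgebra 𝓘(ℝ, E) G :=
  ofBidual (V := E) (fderiv ℝ (fun ν : LieDual E G => h g ν) μ)

/-- The derivative `D_gh(g, μ) ∈ T*_gG`. -/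
def trivializedDg (h : G → LieDual E G → ℝ) (g : G) (μ : LieDual E G) :
    TangentSpace 𝓘(ℝ, E) g →L[ℝ] ℝ :=
  mfderiv 𝓘(ℝ, E) 𝓘(ℝ, ℝ) (fun x : G => h x μ) g

/-- The Type II Lie–Poisson equations on `[0, T]`: `ġ = g · D_μh`,
`μ̇ = -g* · D_gh + ad*_{D_μh} μ`, `g(0) = g₀` and `μ(T) = μ₁`. -/
def LiePoissonEquations (h : G → LieDual E G → ℝ) (T : ℝ) (g₀ : G) (μ₁ : LieDual E G)
    (g : ℝ → G) (μ : ℝ → LieDual E G) : Prop :=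
  (∀ t ∈ Icc 0 T, velocity T g t = translate (g t) (trivializedDμ h (g t) (μ t))) ∧
  (∀ t ∈ Icc 0 T, HasDerivWithinAt μ
    (-cotranslate (g t) (trivializedDg h (g t) (μ t)) +
      coadjoint (trivializedDμ h (g t) (μ t)) (μ t)) (Icc 0 T) t) ∧
  g 0 = g₀ ∧ μ T = μ₁

end LieGroup

end TypeII

end

noncomputable section

namespace TypeII

/-! ### Left translation and the left trivialization of `T*G`. -/

section Translation

variable {E : Type*} [NormedAddCommGroup E] [NormedSpace ℝ E]
  {G : Type*} [TopologicalSpace G] [ChartedSpace E G] [Group G] [LieGroup 𝓘(ℝ, E) ∞ G]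

/-! The left trivialization `(g, p) ↦ (g, g* · p)` identifies `T*G` with `G × 𝔤*`. It turns one
action into the other, matches the endpoint conditions, and carries admissible variations to
admissible variations in both directions. So (i) ⇔ (iii) is a change of variables
(`dAlembert_iff_trivialized`).

For (iii) ⇔ (iv), put `ξ = g⁻¹ · ġ`. The Maurer–Cartan equation along the two-parameter map `(ε, t)
↦ g_ε(t)` says `∂_ε ξ = ∂_t η + [ξ, η]`. Hence at `ε = 0` the integrand of `s` varies by `d/dt ⟨μ,
η⟩ + ⟨δμ, ξ - D_μh⟩ - ⟨μ̇ - ad*_ξ μ + g* · D_gh, η⟩` (`fderivWithin_familyLagrangian`). The total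
derivative integrates to `⟨μ(T), η(T)⟩`, the term prescribed by the principle, since `η(0) = 0`.
What remains is an integral linear in `(η, δμ)`, and it vanishes for all admissible variations
exactly when the Lie–Poisson equations hold (`eulerResidual_eq_zero_iff`, `exists_variation`,
`eqOn_zero_of_integral_mul_eq_zero`).

For (ii) ⇔ (iv), let `B(x)` be the left-invariant frame in a chart. Canonical and trivialized
momenta are related by `μ = a ∘ B(x)`, so `H` in canonical coordinates is `K(x, a ∘ B(x))`, where
`K` is `h` read in the chart. Differentiating `μ = a ∘ B(x)` along a solution produces derivatives
of `B`, whose antisymmetric part is the Lie bracket by the structure equations (`fderiv_frame_sub`).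
This is the origin of the coadjoint term (`hamilton_iff_liePoisson`). -/

theorem mdifferentiableAt_mul_left (a g : G) :
    MDifferentiableAt 𝓘(ℝ, E) 𝓘(ℝ, E) (fun x : G => a * x) g :=
  (contMDiff_mul_left (I := 𝓘(ℝ, E)) (n := ∞) (a := a)).mdifferentiableAt (by simp)

/-- `T_eL_g` as an endomorphism of the model space. -/
def leftDeriv (g : G) : E →L[ℝ] E := translate (E := E) g

/-- `T_gL_{g⁻¹}` as an endomorphism of the model space. -/
def leftDerivInv (g : G) : E →L[ℝ] E := translateInv (E := E) g

-- The chain rule at `1` for `L_{g⁻¹} ∘ L_g` evaluates the outer derivative at `g * 1`, which equals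
-- `g` only propositionally. Working with endomorphisms of `E` allows the base point to be
-- rewritten.
omit [LieGroup 𝓘(ℝ, E) ∞ G] in
theorem leftDerivInv_eq (g : G) : leftDerivInv (E := E) g =
    mfderiv 𝓘(ℝ, E) 𝓘(ℝ, E) (fun x : G => g⁻¹ * x) (g * 1) := by
  rw [mul_one]; rfl

omit [LieGroup 𝓘(ℝ, E) ∞ G] in
theorem leftDeriv_eq (g : G) : leftDeriv (E := E) g =
    mfderiv 𝓘(ℝ, E) 𝓘(ℝ, E) (fun x : G => g * x) (g⁻¹ * g) := by
  rw [inv_mul_cancel]; rfl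

theorem leftDerivInv_leftDeriv (g : G) (ξ : E) : leftDerivInv g (leftDeriv g ξ) = ξ := by
  have h := mfderiv_comp (I := 𝓘(ℝ, E)) (I' := 𝓘(ℝ, E)) (I'' := 𝓘(ℝ, E)) (1 : G)
    (g := fun x : G => g⁻¹ * x) (f := fun x : G => g * x)
    (mdifferentiableAt_mul_left _ _) (mdifferentiableAt_mul_left _ _)
  have h2 : (fun x : G => g⁻¹ * x) ∘ (fun x : G => g * x) = id := by ext x; simp
  rw [h2, mfderiv_id] at h
  rw [leftDerivInv_eq]
  exact (DFunLike.congr_fun h ξ).symm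

theorem leftDeriv_leftDerivInv (g : G) (v : E) : leftDeriv g (leftDerivInv g v) = v := by
  have h := mfderiv_comp (I := 𝓘(ℝ, E)) (I' := 𝓘(ℝ, E)) (I'' := 𝓘(ℝ, E)) g
    (g := fun x : G => g * x) (f := fun x : G => g⁻¹ * x)
    (mdifferentiableAt_mul_left _ _) (mdifferentiableAt_mul_left _ _)
  have h2 : (fun x : G => g * x) ∘ (fun x : G => g⁻¹ * x) = id := by ext x; simp
  rw [h2, mfderiv_id] at h
  rw [leftDeriv_eq]
  exact (DFunLike.congr_fun h v).symm

theorem cotranslateInv_cotranslate (g : G) (p : TangentSpace 𝓘(ℝ, E) g →L[ℝ] ℝ) :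
    cotranslateInv g (cotranslate g p) = p :=
  ContinuousLinearMap.ext fun v => congrArg p (leftDeriv_leftDerivInv (E := E) g v)

theorem cotranslate_cotranslateInv (g : G) (μ : LieDual E G) :
    cotranslate g (cotranslateInv g μ) = μ :=
  ContinuousLinearMap.ext fun v => congrArg μ (leftDerivInv_leftDeriv (E := E) g v)

/-- The inverse `(g, μ) ↦ (g, g*⁻¹ · μ)` of the left trivialization. -/
def ofMomentum (g : G) (μ : LieDual E G) : CotangentBundle E G := ⟨g, cotranslateInv g μ⟩

theorem momentum_ofMomentum (g : G) (μ : LieDual E G) : momentum (ofMomentum g μ) = μ :=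
  cotranslate_cotranslateInv g μ

theorem ofMomentum_momentum (q : CotangentBundle E G) : ofMomentum q.1 (momentum q) = q := by
  rcases q with ⟨g, p⟩
  simp only [ofMomentum, momentum, cotranslateInv_cotranslate]

theorem endpoint_iff (q : CotangentBundle E G) (μ₁ : LieDual E G) :
    q.2 = cotranslateInv q.1 μ₁ ↔ momentum q = μ₁ :=
  ⟨fun h => by rw [momentum, h, cotranslate_cotranslateInv],
    fun h => by rw [← h, momentum, cotranslateInv_cotranslate]⟩

theorem hamiltonian_eq (H : CotangentBundle E G → ℝ) (q : CotangentBundle E G) :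
    H q = trivializedHamiltonian H q.1 (momentum q) := by
  conv_lhs => rw [← ofMomentum_momentum q]
  rfl

end Translation

/-! ### The left-invariant frame in a chart, its inverse, and their smoothness. -/

section Frame

variable {E : Type*} [NormedAddCommGroup E] [NormedSpace ℝ E]
  {G : Type*} [TopologicalSpace G] [ChartedSpace E G]

/-- The derivative of a chart at a point, as an endomorphism of the model space. -/
def chartDeriv (φ : OpenPartialHomeomorph G E) (g : G) : E →L[ℝ] E :=
  mfderiv 𝓘(ℝ, E) 𝓘(ℝ, E) φ g

/-- The derivative of the inverse of a chart, as an endomorphism of the model space. -/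
def chartSymmDeriv (φ : OpenPartialHomeomorph G E) (x : E) : E →L[ℝ] E :=
  mfderiv 𝓘(ℝ, E) 𝓘(ℝ, E) φ.symm x

/-- The left-invariant frame in a chart: `ξ ↦ T_gφ (g · ξ)` at `g = φ⁻¹(x)`. -/
def frame [Group G] (φ : OpenPartialHomeomorph G E) (x : E) : E →L[ℝ] E :=
  (chartDeriv φ (φ.symm x)).comp (leftDeriv (φ.symm x))

/-- The left-invariant coframe in a chart, inverse to `frame`. -/
def coframe [Group G] (φ : OpenPartialHomeomorph G E) (x : E) : E →L[ℝ] E :=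
  (leftDerivInv (φ.symm x)).comp (chartSymmDeriv φ x)

variable {φ : OpenPartialHomeomorph G E}

theorem mdifferentiable_chart [IsManifold 𝓘(ℝ, E) ∞ G]
    (hφ : φ ∈ IsManifold.maximalAtlas 𝓘(ℝ, E) ∞ G) :
    φ.MDifferentiable 𝓘(ℝ, E) 𝓘(ℝ, E) :=
  ⟨(contMDiffOn_of_mem_maximalAtlas hφ).mdifferentiableOn (by simp),
    (contMDiffOn_symm_of_mem_maximalAtlas hφ).mdifferentiableOn (by simp)⟩

section
variable [IsManifold 𝓘(ℝ, E) ∞ G] (hφ : φ ∈ IsManifold.maximalAtlas 𝓘(ℝ, E) ∞ G)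
include hφ

theorem chartSymmDeriv_chartDeriv {g : G} (hg : g ∈ φ.source) (v : E) :
    chartSymmDeriv φ (φ g) (chartDeriv φ g v) = v :=
  DFunLike.congr_fun ((mdifferentiable_chart hφ).symm_comp_deriv hg) v

theorem chartDeriv_chartSymmDeriv {x : E} (hx : x ∈ φ.target) (v : E) :
    chartDeriv φ (φ.symm x) (chartSymmDeriv φ x v) = v :=
  DFunLike.congr_fun ((mdifferentiable_chart hφ).comp_symm_deriv hx) v

theorem chartDeriv_inverse {g : G} (hg : g ∈ φ.source) :
    (chartDeriv φ g).inverse = chartSymmDeriv φ (φ g) := by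
  refine ContinuousLinearMap.inverse_eq ?_ ?_
  · ext v
    have := chartDeriv_chartSymmDeriv hφ (φ.map_source hg) v
    rwa [φ.left_inv hg] at this
  · ext v
    exact chartSymmDeriv_chartDeriv hφ hg v

end

theorem frame_apply [Group G] (x ξ : E) :
    frame φ x ξ = chartDeriv φ (φ.symm x) (leftDeriv (φ.symm x) ξ) := rfl

theorem coframe_apply [Group G] (x v : E) :
    coframe φ x v = leftDerivInv (φ.symm x) (chartSymmDeriv φ x v) := rfl

variable [Group G] [LieGroup 𝓘(ℝ, E) ∞ G] (hφ : φ ∈ IsManifold.maximalAtlas 𝓘(ℝ, E) ∞ G)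
include hφ

theorem coframe_frame {x : E} (hx : x ∈ φ.target) (ξ : E) : coframe φ x (frame φ x ξ) = ξ := by
  have := chartSymmDeriv_chartDeriv hφ (φ.map_target hx) (leftDeriv (φ.symm x) ξ)
  rw [φ.right_inv hx] at this
  rw [coframe_apply, frame_apply, this, leftDerivInv_leftDeriv]

theorem frame_coframe {x : E} (hx : x ∈ φ.target) (v : E) : frame φ x (coframe φ x v) = v := by
  rw [coframe_apply, frame_apply, leftDeriv_leftDerivInv, chartDeriv_chartSymmDeriv hφ hx]

theorem frame_inverse {x : E} (hx : x ∈ φ.target) : (frame φ x).inverse = coframe φ x :=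
  ContinuousLinearMap.inverse_eq (ContinuousLinearMap.ext (frame_coframe hφ hx))
    (ContinuousLinearMap.ext (coframe_frame hφ hx))

theorem contDiffAt_chart_mul {x y : E} {ψ : OpenPartialHomeomorph G E}
    (hψ : ψ ∈ IsManifold.maximalAtlas 𝓘(ℝ, E) ∞ G) (hx : x ∈ φ.target)
    (hy : y ∈ ψ.target) (hxy : φ.symm x * ψ.symm y ∈ φ.source) :
    ContDiffAt ℝ ∞ (Function.uncurry fun x y => φ (φ.symm x * ψ.symm y)) (x, y) := by
  rw [← contMDiffAt_iff_contDiffAt]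
  have h1 : ContMDiffAt 𝓘(ℝ, E × E) 𝓘(ℝ, E) ∞ (fun z : E × E => φ.symm z.1) (x, y) :=
    ContMDiffAt.comp (x, y) (g := φ.symm) (contMDiffAt_symm_of_mem_maximalAtlas hφ hx)
      contDiff_fst.contMDiff.contMDiffAt
  have h2 : ContMDiffAt 𝓘(ℝ, E × E) 𝓘(ℝ, E) ∞ (fun z : E × E => ψ.symm z.2) (x, y) :=
    ContMDiffAt.comp (x, y) (g := ψ.symm) (contMDiffAt_symm_of_mem_maximalAtlas hψ hy)
      contDiff_snd.contMDiff.contMDiffAt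
  exact ContMDiffAt.comp (x, y) (g := φ) (contMDiffAt_of_mem_maximalAtlas hφ hxy) (h1.mul h2)

-- The tangent space at `g` is identified with `E` through the preferred chart at `g`, so that chart
-- has identity derivative there.
omit hφ in
theorem chartDeriv_chartAt_self (g : G) :
    chartDeriv (chartAt E g) g = ContinuousLinearMap.id ℝ E := by
  have h := mfderiv_extChartAt_self (I := 𝓘(ℝ, E)) (x := g)
  refine Eq.trans ?_ h
  simp only [extChartAt, OpenPartialHomeomorph.extend, mfld_simps]
  rfl

omit hφ in
theorem hasMFDerivAt_chartAt_symm_self (g : G) :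
    HasMFDerivAt 𝓘(ℝ, E) 𝓘(ℝ, E) (chartAt E g).symm (chartAt E g g)
      (ContinuousLinearMap.id ℝ E) := by
  have hψ := IsManifold.chart_mem_maximalAtlas (I := 𝓘(ℝ, E)) (n := ∞) g
  have h1 := mem_chart_source E g
  have h := ((mdifferentiable_chart hψ).mdifferentiableAt_symm
    ((chartAt E g).map_source h1)).hasMFDerivAt
  have e : chartSymmDeriv (chartAt E g) (chartAt E g g) = ContinuousLinearMap.id ℝ E := by
    ext v
    have h3 := chartSymmDeriv_chartDeriv hψ h1 v
    rwa [chartDeriv_chartAt_self] at h3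
  rw [← e]
  exact h

theorem hasMFDerivAt_chart {g : G} (hg : g ∈ φ.source) :
    HasMFDerivAt 𝓘(ℝ, E) 𝓘(ℝ, E) φ g (chartDeriv (E := E) φ g) :=
  ((mdifferentiable_chart hφ).mdifferentiableAt hg).hasMFDerivAt

omit hφ in
theorem hasMFDerivAt_mul_left_one (g : G) :
    HasMFDerivAt 𝓘(ℝ, E) 𝓘(ℝ, E) (fun x : G => g * x) 1 (leftDeriv (E := E) g) :=
  (mdifferentiableAt_mul_left g 1).hasMFDerivAt

/-- Exhibits the frame as a partial derivative of the multiplication in charts, in the second factor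
at the identity. The fibrewise definition does not show smooth dependence on `x`; this formula does.
-/
theorem frame_eq_fderiv {x : E} (hx : x ∈ φ.target) :
    frame φ x = fderiv ℝ (fun y => φ (φ.symm x * (chartAt E (1 : G)).symm y))
      (chartAt E (1 : G) 1) := by
  have e1 : (chartAt E (1 : G)).symm (chartAt E (1 : G) 1) = 1 :=
    (chartAt E (1 : G)).left_inv (mem_chart_source E 1)
  have d1 := hasMFDerivAt_chartAt_symm_self (E := E) (1 : G)
  have d2 := hasMFDerivAt_mul_left_one (E := E) (φ.symm x)
  rw [← e1] at d2
  have d3 := hasMFDerivAt_chart hφ (φ.map_target hx)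
  have e2 : φ.symm x = φ.symm x * (chartAt E (1 : G)).symm (chartAt E (1 : G) 1) := by
    rw [e1, mul_one]
  have e3 : HasMFDerivAt 𝓘(ℝ, E) 𝓘(ℝ, E) φ
      (φ.symm x * (chartAt E (1 : G)).symm (chartAt E (1 : G) 1))
        (chartDeriv (E := E) φ (φ.symm x)) := by
    rw [← e2]; exact d3
  have d4 : HasMFDerivAt 𝓘(ℝ, E) 𝓘(ℝ, E) (fun y => φ.symm x * (chartAt E (1 : G)).symm y)
      (chartAt E (1 : G) 1) (leftDeriv (E := E) (φ.symm x)) := d2.comp _ d1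
  have d5 : HasMFDerivAt 𝓘(ℝ, E) 𝓘(ℝ, E) (fun y => φ (φ.symm x * (chartAt E (1 : G)).symm y))
      (chartAt E (1 : G) 1) (frame (E := E) φ x) := HasMFDerivAt.comp _ e3 d4
  have d6 : HasFDerivAt (fun y => φ (φ.symm x * (chartAt E (1 : G)).symm y)) (frame (E := E) φ x)
      (chartAt E (1 : G) 1) := hasMFDerivAt_iff_hasFDerivAt.1 d5
  exact d6.fderiv.symm

theorem contDiffOn_frame : ContDiffOn ℝ ∞ (frame φ) φ.target := by
  have hψ := IsManifold.chart_mem_maximalAtlas (I := 𝓘(ℝ, E)) (n := ∞) (1 : G)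
  have h1 : (1 : G) ∈ (chartAt E (1 : G)).source := mem_chart_source E 1
  have e1 : (chartAt E (1 : G)).symm (chartAt E (1 : G) 1) = 1 := (chartAt E (1 : G)).left_inv h1
  intro x hx
  refine ContDiffAt.contDiffWithinAt ?_
  -- The derivative in one variable of a jointly smooth map depends smoothly on the other variable.
  have key := ContDiffAt.fderiv (𝕜 := ℝ) (m := ∞) (g := fun _ => chartAt E (1 : G) 1)
    (contDiffAt_chart_mul hφ hψ hx ((chartAt E (1 : G)).map_source h1)
      (by rw [e1, mul_one]; exact φ.map_target hx)) contDiffAt_const (by simp)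
  refine key.congr_of_eventuallyEq ?_
  filter_upwards [φ.open_target.mem_nhds hx] with z hz
  exact frame_eq_fderiv hφ hz

/-- Inversion of continuous linear maps is smooth at an invertible map, and the coframe is the
inverse of the smooth frame. -/
theorem contDiffOn_coframe [CompleteSpace E] : ContDiffOn ℝ ∞ (coframe φ) φ.target := by
  intro x hx
  let e : E ≃L[ℝ] E := ContinuousLinearEquiv.equivOfInverse (frame φ x) (coframe φ x)
    (coframe_frame hφ hx) (frame_coframe hφ hx)
  have h := (contDiffAt_map_inverse (n := ∞) e).comp_contDiffWithinAt (f := frame φ) x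
    (contDiffOn_frame hφ x hx)
  exact h.congr (fun y hy => (frame_inverse hφ hy).symm) (frame_inverse hφ hx).symm

end Frame

/-! ### Structure equations of the left-invariant frame. -/

section Bracket

variable {E : Type*} [NormedAddCommGroup E] [NormedSpace ℝ E] [FiniteDimensional ℝ E]
  {G : Type*} [TopologicalSpace G] [ChartedSpace E G] [Group G] [LieGroup 𝓘(ℝ, E) ∞ G]
  {φ : OpenPartialHomeomorph G E} (hφ : φ ∈ IsManifold.maximalAtlas 𝓘(ℝ, E) ∞ G)
include hφ

omit [FiniteDimensional ℝ E] in
open VectorField in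
theorem mpullback_invariant {x : E} (hx : x ∈ φ.target) (ξ : E) :
    (mpullback 𝓘(ℝ, E) 𝓘(ℝ, E) φ.symm (mulInvariantVectorField (I := 𝓘(ℝ, E)) (G := G) ξ) x : E)
      = frame φ x ξ := by
  have h : (chartSymmDeriv φ x).inverse = chartDeriv φ (φ.symm x) := by
    have := chartSymmDeriv_chartDeriv hφ (φ.map_target hx)
    rw [φ.right_inv hx] at this
    exact ContinuousLinearMap.inverse_eq (ContinuousLinearMap.ext this)
      (ContinuousLinearMap.ext (chartDeriv_chartSymmDeriv hφ hx))
  rw [frame_apply, ← h]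
  rfl

open VectorField in
/-- The structure equations of a Lie group for the left-invariant frame in a chart. -/
theorem fderiv_frame_sub {x : E} (hx : x ∈ φ.target) (ξ η : E) :
    fderiv ℝ (frame φ) x (frame φ x ξ) η - fderiv ℝ (frame φ) x (frame φ x η) ξ =
      frame φ x (adjointMap (G := G) ξ η) := by
  have := FiniteDimensional.complete ℝ E
  have : LieGroup 𝓘(ℝ, E) (minSmoothness ℝ 3) G := by
    rw [minSmoothness_of_isRCLikeNormedField]; infer_instance
  have : IsManifold 𝓘(ℝ, E) (minSmoothness ℝ 2) G := by
    rw [minSmoothness_of_isRCLikeNormedField]; infer_instance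
  -- Pullback along the inverse chart commutes with Lie brackets. On `E` the bracket is the
  -- difference of directional derivatives, and on `G` the bracket of left-invariant fields is the
  -- left-invariant field of the Lie algebra bracket.
  have key := mpullback_mlieBracket (I := 𝓘(ℝ, E)) (I' := 𝓘(ℝ, E)) (n := ∞) (f := φ.symm) (x₀ := x)
    (mdifferentiableAt_mulInvariantVectorField (I := 𝓘(ℝ, E)) (G := G) ξ)
    (mdifferentiableAt_mulInvariantVectorField (I := 𝓘(ℝ, E)) (G := G) η)
    (contMDiffAt_symm_of_mem_maximalAtlas hφ hx)
    (by rw [minSmoothness_of_isRCLikeNormedField]; exact WithTop.coe_le_coe.2 le_top)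
  have hev (ζ : E) : (mpullback 𝓘(ℝ, E) 𝓘(ℝ, E) φ.symm
      (mulInvariantVectorField (I := 𝓘(ℝ, E)) (G := G) ζ)) =ᶠ[𝓝 x] fun y => frame φ y ζ := by
    filter_upwards [φ.open_target.mem_nhds hx] with y hy
    exact mpullback_invariant hφ hy ζ
  rw [Filter.EventuallyEq.mlieBracket_vectorField_eq (hev ξ) (hev η)] at key
  have e3 (V W : Π y : E, TangentSpace 𝓘(ℝ, E) y) :
      mlieBracket 𝓘(ℝ, E) V W x = lieBracket ℝ V W x := by
    rw [← mlieBracketWithin_univ, mlieBracketWithin_eq_lieBracketWithin]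
    exact congrFun (lieBracketWithin_univ (𝕜 := ℝ) (V := (V : E → E)) (W := W)) x
  have hd : DifferentiableAt ℝ (frame φ) x :=
    ((contDiffOn_frame hφ).contDiffAt (φ.open_target.mem_nhds hx)).differentiableAt (by simp)
  have hfd (ζ v : E) : fderiv ℝ (fun y => frame φ y ζ) x v = fderiv ℝ (frame φ) x v ζ := by
    have h := hd.hasFDerivAt.clm_apply (hasFDerivAt_const ζ x)
    rw [h.fderiv]
    simp
  have e1 : lieBracket ℝ (fun y => frame φ y ξ) (fun y => frame φ y η) x =
    fderiv ℝ (frame φ) x (frame φ x ξ) η - fderiv ℝ (frame φ) x (frame φ x η) ξ := by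
    rw [← hfd, ← hfd]; rfl
  rw [← e1]
  have e2 (v w : GroupLieAlgebra 𝓘(ℝ, E) G) : mpullback 𝓘(ℝ, E) 𝓘(ℝ, E) φ.symm
      (mlieBracket 𝓘(ℝ, E) (mulInvariantVectorField v) (mulInvariantVectorField w)) x =
      mpullback 𝓘(ℝ, E) 𝓘(ℝ, E) φ.symm (mulInvariantVectorField ⁅v, w⁆) x := by
    rw [← mulInvariantVector_mlieBracket]; rfl
  exact ((key.trans (e3 _ _)).symm.trans (e2 ξ η)).trans (mpullback_invariant hφ hx _)

end Bracket

/-! ### Canonical versus left-trivialized momentum. -/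

section Momentum

variable {E : Type*} [NormedAddCommGroup E] [NormedSpace ℝ E]
  {G : Type*} [TopologicalSpace G] [ChartedSpace E G] [Group G] [LieGroup 𝓘(ℝ, E) ∞ G]
  {φ : OpenPartialHomeomorph G E} (hφ : φ ∈ IsManifold.maximalAtlas 𝓘(ℝ, E) ∞ G)

include hφ in
theorem canonicalMomentum_apply {q : CotangentBundle E G} (hq : q.1 ∈ φ.source) (v : E) :
    canonicalMomentum φ q v = q.2 (chartSymmDeriv φ (φ q.1) v) := by
  rw [← chartDeriv_inverse hφ hq]
  rfl

omit [LieGroup 𝓘(ℝ, E) ∞ G] in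
theorem momentum_apply (q : CotangentBundle E G) (ξ : E) :
    momentum q ξ = q.2 (leftDeriv (E := E) q.1 ξ) := rfl

include hφ in
theorem canonicalMomentum_eq {q : CotangentBundle E G} (hq : q.1 ∈ φ.source) :
    canonicalMomentum φ q = (momentum q).comp (coframe φ (φ q.1)) := by
  ext v
  rw [canonicalMomentum_apply hφ hq]
  change _ = momentum q (coframe φ (φ q.1) v)
  rw [momentum_apply, coframe_apply, φ.left_inv hq, leftDeriv_leftDerivInv]

include hφ in
theorem momentum_eq {q : CotangentBundle E G} (hq : q.1 ∈ φ.source) :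
    momentum q = (canonicalMomentum φ q).comp (frame φ (φ q.1)) := by
  rw [canonicalMomentum_eq hφ hq]
  ext v
  exact congrArg (momentum q) (coframe_frame hφ (φ.map_source hq) v).symm

/-- In the bundle trivialization at `(f x).1`, a covector is represented by its canonical momentum
in the preferred chart. Smoothness in `T*G` thus becomes smoothness of canonical coordinates. -/
theorem contMDiffWithinAt_cotangent_iff {F : Type*} [NormedAddCommGroup F] [NormedSpace ℝ F]
    {M : Type*} [TopologicalSpace M] [ChartedSpace F M]
    {f : M → CotangentBundle E G} {s : Set M} {x : M} :
    ContMDiffWithinAt 𝓘(ℝ, F) (𝓘(ℝ, E).prod 𝓘(ℝ, E →L[ℝ] ℝ)) ∞ f s x ↔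
      ContMDiffWithinAt 𝓘(ℝ, F) 𝓘(ℝ, E) ∞ (fun y => (f y).1) s x ∧
      ContMDiffWithinAt 𝓘(ℝ, F) 𝓘(ℝ, E →L[ℝ] ℝ) ∞
        (fun y => canonicalMomentum (chartAt E (f x).1) (f y)) s x := by
  rw [contMDiffWithinAt_hom_bundle]
  refine and_congr_right fun h => ?_
  have hψ := IsManifold.chart_mem_maximalAtlas (I := 𝓘(ℝ, E)) (n := ∞) (f x).1
  have hsrc := h.continuousWithinAt.preimage_mem_nhdsWithin
    ((chartAt E (f x).1).open_source.mem_nhds (mem_chart_source E (f x).1))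
  have key : ∀ q : CotangentBundle E G, q.1 ∈ (chartAt E (f x).1).source →
      ContinuousLinearMap.inCoordinates E (TangentSpace 𝓘(ℝ, E)) ℝ (Trivial G ℝ) (f x).1 q.1 (f x).1
        q.1 q.2 = canonicalMomentum (chartAt E (f x).1) q := by
    intro q hq
    ext v
    rw [canonicalMomentum_apply hψ hq]
    simp only [ContinuousLinearMap.inCoordinates]
    rw [TangentBundle.symmL_trivializationAt hq]
    simp
    rfl
  have hev : (fun y => ContinuousLinearMap.inCoordinates E (TangentSpace 𝓘(ℝ, E)) ℝ (Trivial G ℝ)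
      (f x).1 (f y).1 (f x).1 (f y).1 (f y).2) =ᶠ[𝓝[s] x]
      fun y => canonicalMomentum (chartAt E (f x).1) (f y) := by
    filter_upwards [hsrc] with y hy
    exact key (f y) hy
  have hx := key (f x) (mem_chart_source E (f x).1)
  exact ⟨fun h => h.congr_of_eventuallyEq hev.symm hx.symm,
    fun h => h.congr_of_eventuallyEq hev hx⟩

end Momentum

/-! ### Smoothness of the left trivialization and of its inverse. -/

section Smooth

variable {E : Type*} [NormedAddCommGroup E] [NormedSpace ℝ E]
  {G : Type*} [TopologicalSpace G] [ChartedSpace E G] [Group G] [LieGroup 𝓘(ℝ, E) ∞ G]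
  {F : Type*} [NormedAddCommGroup F] [NormedSpace ℝ F] {s : Set F} {x : F}

theorem contMDiffWithinAt_momentum {f : F → CotangentBundle E G}
    (hf : ContMDiffWithinAt 𝓘(ℝ, F) (𝓘(ℝ, E).prod 𝓘(ℝ, E →L[ℝ] ℝ)) ∞ f s x) :
    ContDiffWithinAt ℝ ∞ (fun y => momentum (f y)) s x := by
  obtain ⟨h1, h2⟩ := contMDiffWithinAt_cotangent_iff.1 hf
  have hψ := IsManifold.chart_mem_maximalAtlas (I := 𝓘(ℝ, E)) (n := ∞) (f x).1
  have hx := mem_chart_source E (f x).1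
  have hsrc := h1.continuousWithinAt.preimage_mem_nhdsWithin
    ((chartAt E (f x).1).open_source.mem_nhds hx)
  have h3 : ContDiffWithinAt ℝ ∞ (fun y => chartAt E (f x).1 (f y).1) s x :=
    (ContMDiffAt.comp_contMDiffWithinAt x (contMDiffAt_of_mem_maximalAtlas hψ hx)
      h1).contDiffWithinAt
  have h4 : ContDiffAt ℝ ∞ (frame (chartAt E (f x).1)) (chartAt E (f x).1 (f x).1) :=
    (contDiffOn_frame hψ).contDiffAt ((chartAt E (f x).1).open_target.mem_nhds
      ((chartAt E (f x).1).map_source hx))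
  have h5 := h2.contDiffWithinAt.clm_comp (h4.comp_contDiffWithinAt x h3)
  refine h5.congr_of_eventuallyEq ?_ (momentum_eq hψ hx)
  filter_upwards [hsrc] with y hy
  exact momentum_eq hψ hy

theorem contMDiffWithinAt_ofMomentum [CompleteSpace E] {g : F → G} {μ : F → LieDual E G}
    (hg : ContMDiffWithinAt 𝓘(ℝ, F) 𝓘(ℝ, E) ∞ g s x) (hμ : ContDiffWithinAt ℝ ∞ μ s x) :
    ContMDiffWithinAt 𝓘(ℝ, F) (𝓘(ℝ, E).prod 𝓘(ℝ, E →L[ℝ] ℝ)) ∞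
      (fun y => ofMomentum (g y) (μ y)) s x := by
  refine contMDiffWithinAt_cotangent_iff.2 ⟨hg, ?_⟩
  have hψ := IsManifold.chart_mem_maximalAtlas (I := 𝓘(ℝ, E)) (n := ∞) (g x)
  have hx := mem_chart_source E (g x)
  have hsrc := hg.continuousWithinAt.preimage_mem_nhdsWithin
    ((chartAt E (g x)).open_source.mem_nhds hx)
  have h3 : ContDiffWithinAt ℝ ∞ (fun y => chartAt E (g x) (g y)) s x :=
    (ContMDiffAt.comp_contMDiffWithinAt x (contMDiffAt_of_mem_maximalAtlas hψ hx)
      hg).contDiffWithinAt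
  have h4 : ContDiffAt ℝ ∞ (coframe (chartAt E (g x))) (chartAt E (g x) (g x)) :=
    (contDiffOn_coframe hψ).contDiffAt ((chartAt E (g x)).open_target.mem_nhds
      ((chartAt E (g x)).map_source hx))
  have h5 := hμ.clm_comp (h4.comp_contDiffWithinAt x h3)
  have key : ∀ y, g y ∈ (chartAt E (g x)).source →
      canonicalMomentum (chartAt E (g x)) (ofMomentum (g y) (μ y)) =
        (μ y).comp (coframe (chartAt E (g x)) (chartAt E (g x) (g y))) := fun y hy => by
    rw [canonicalMomentum_eq hψ hy, momentum_ofMomentum]; rfl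
  refine ContDiffWithinAt.contMDiffWithinAt (h5.congr_of_eventuallyEq ?_ (key x hx))
  filter_upwards [hsrc] with y hy
  exact key y hy

theorem contMDiffWithinAt_fst {f : F → CotangentBundle E G}
    (hf : ContMDiffWithinAt 𝓘(ℝ, F) (𝓘(ℝ, E).prod 𝓘(ℝ, E →L[ℝ] ℝ)) ∞ f s x) :
    ContMDiffWithinAt 𝓘(ℝ, F) 𝓘(ℝ, E) ∞ (fun y => (f y).1) s x :=
  (contMDiffWithinAt_cotangent_iff.1 hf).1

end Smooth

/-! ### The partial derivatives of `h` as partial derivatives of one function on `E × E*`. -/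

section Hamiltonian

variable {E : Type*} [NormedAddCommGroup E] [NormedSpace ℝ E]
  {G : Type*} [TopologicalSpace G] [ChartedSpace E G] [Group G]

/-- The left-trivialized Hamiltonian with the position read in a chart. -/
def chartHamiltonian (H : CotangentBundle E G → ℝ) (φ : OpenPartialHomeomorph G E)
    (z : E × (E →L[ℝ] ℝ)) : ℝ :=
  trivializedHamiltonian H (φ.symm z.1) z.2

variable [LieGroup 𝓘(ℝ, E) ∞ G]
  {φ : OpenPartialHomeomorph G E} (hφ : φ ∈ IsManifold.maximalAtlas 𝓘(ℝ, E) ∞ G)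
  {H : CotangentBundle E G → ℝ}
  (hH : ContMDiff (𝓘(ℝ, E).prod 𝓘(ℝ, E →L[ℝ] ℝ)) 𝓘(ℝ, ℝ) ∞ H)

include hH in
theorem contDiffWithinAt_trivializedHamiltonian [CompleteSpace E]
    {F : Type*} [NormedAddCommGroup F] [NormedSpace ℝ F] {s : Set F} {x : F}
    {g : F → G} {μ : F → LieDual E G}
    (hg : ContMDiffWithinAt 𝓘(ℝ, F) 𝓘(ℝ, E) ∞ g s x) (hμ : ContDiffWithinAt ℝ ∞ μ s x) :
    ContDiffWithinAt ℝ ∞ (fun y => trivializedHamiltonian H (g y) (μ y)) s x :=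
  (ContMDiffAt.comp_contMDiffWithinAt x hH.contMDiffAt
    (contMDiffWithinAt_ofMomentum hg hμ)).contDiffWithinAt

include hφ hH

theorem contDiffAt_chartHamiltonian [CompleteSpace E] {x : E} (hx : x ∈ φ.target)
    (μ : E →L[ℝ] ℝ) : ContDiffAt ℝ ∞ (chartHamiltonian H φ) (x, μ) := by
  refine contDiffWithinAt_univ.1 (contDiffWithinAt_trivializedHamiltonian hH ?_
    contDiff_snd.contDiffWithinAt)
  exact (ContMDiffAt.comp (x, μ) (contMDiffAt_symm_of_mem_maximalAtlas hφ hx)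
    contDiff_fst.contMDiff.contMDiffAt).contMDiffWithinAt

variable [FiniteDimensional ℝ E]

theorem apply_trivializedDμ {g : G} (hg : g ∈ φ.source) (μ ν : LieDual E G) :
    ν (trivializedDμ (trivializedHamiltonian H) g μ) =
      fderiv ℝ (chartHamiltonian H φ) (φ g, μ) (0, ν) := by
  have := FiniteDimensional.complete ℝ E
  have hK := ((contDiffAt_chartHamiltonian hφ hH (φ.map_source hg) μ).differentiableAt
    (by simp)).hasFDerivAt
  have h := hK.comp μ ((hasFDerivAt_const (φ g) μ).prodMk (hasFDerivAt_id (𝕜 := ℝ) μ))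
  have e : (chartHamiltonian H φ ∘ Prod.mk (φ g)) = trivializedHamiltonian H g := by
    ext ν
    simp [chartHamiltonian, φ.left_inv hg]
  rw [e] at h
  refine (apply_ofBidual _ _).trans ?_
  rw [show (fun ν : LieDual E G => trivializedHamiltonian H g ν) =
    trivializedHamiltonian H g from rfl,
    h.fderiv]
  simp

/-- Chain rule for `h(·, μ) = K(φ(·), μ)` near `g`; the vector `g · v` has chart representative
`frame φ (φ g) v`. -/
theorem cotranslate_trivializedDg {g : G} (hg : g ∈ φ.source) (μ : LieDual E G) (v : E) :
    cotranslate g (trivializedDg (trivializedHamiltonian H) g μ) v =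
      fderiv ℝ (chartHamiltonian H φ) (φ g, μ) (frame φ (φ g) v, 0) := by
  have := FiniteDimensional.complete ℝ E
  have hK := ((contDiffAt_chartHamiltonian hφ hH (φ.map_source hg) μ).differentiableAt
    (by simp)).hasFDerivAt
  have h : HasFDerivAt (chartHamiltonian H φ ∘ fun x => (x, μ)) _ (φ g) :=
    HasFDerivAt.comp (φ g) hK ((hasFDerivAt_id (𝕜 := ℝ) (φ g)).prodMk (hasFDerivAt_const μ (φ g)))
  have h2 := HasMFDerivAt.comp g h.hasMFDerivAt (hasMFDerivAt_chart hφ hg)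
  have h3 := h2.congr_of_eventuallyEq (f₁ := fun x => trivializedHamiltonian H x μ) (by
    filter_upwards [φ.open_source.mem_nhds hg] with y hy
    simp [chartHamiltonian, φ.left_inv hy])
  have h4 := DFunLike.congr_fun h3.mfderiv (leftDeriv (E := E) g v)
  refine Eq.trans h4 ?_
  rw [frame_apply, φ.left_inv hg]
  change fderiv ℝ (chartHamiltonian H φ) (φ g, μ) (_, _) = _
  rfl

end Hamiltonian

/-! ### Hamilton's equations in charts and the Lie–Poisson equations. -/

section Hamilton

variable {E : Type*} [NormedAddCommGroup E] [NormedSpace ℝ E]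
  {G : Type*} [TopologicalSpace G] [ChartedSpace E G]

theorem hasDerivWithinAt_chart_comp [IsManifold 𝓘(ℝ, E) ∞ G] {φ : OpenPartialHomeomorph G E}
    (hφ : φ ∈ IsManifold.maximalAtlas 𝓘(ℝ, E) ∞ G) {T : ℝ} {g : ℝ → G} {t : ℝ}
    (hg : ContMDiffWithinAt 𝓘(ℝ, ℝ) 𝓘(ℝ, E) ∞ g (Icc 0 T) t) (ht : g t ∈ φ.source) :
    HasDerivWithinAt (fun s => φ (g s)) (chartDeriv φ (g t) (velocity T g t)) (Icc 0 T) t := by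
  have h1 := (hg.mdifferentiableWithinAt (by simp)).hasMFDerivWithinAt
  have h2 := (((mdifferentiable_chart hφ).mdifferentiableAt ht).hasMFDerivAt).comp_hasMFDerivWithinAt
    t h1
  let D : ℝ →L[ℝ] E := mfderivWithin 𝓘(ℝ, ℝ) 𝓘(ℝ, E) g (Icc 0 T) t
  have h3 : HasFDerivWithinAt (fun s => φ (g s)) ((chartDeriv φ (g t)).comp D) (Icc 0 T) t :=
    hasMFDerivWithinAt_iff_hasFDerivWithinAt.1 h2
  exact h3.hasDerivWithinAt

variable [FiniteDimensional ℝ E] [Group G] [LieGroup 𝓘(ℝ, E) ∞ G]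
  {φ : OpenPartialHomeomorph G E} (hφ : φ ∈ IsManifold.maximalAtlas 𝓘(ℝ, E) ∞ G)
  {H : CotangentBundle E G → ℝ}
  (hH : ContMDiff (𝓘(ℝ, E).prod 𝓘(ℝ, E →L[ℝ] ℝ)) 𝓘(ℝ, ℝ) ∞ H)

-- The covector with canonical coordinates `(x, a)` has momentum `a ∘ frame φ x`, by unfolding.
omit [FiniteDimensional ℝ E] in
theorem hamiltonian_ofCanonical (x : E) (a : E →L[ℝ] ℝ) :
    H (ofCanonical φ x a) = chartHamiltonian H φ (x, a.comp (frame φ x)) :=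
  hamiltonian_eq H _

include hφ hH

theorem canonicalDp_eq {q : CotangentBundle E G} (hq : q.1 ∈ φ.source) :
    canonicalDp H φ (φ q.1) (canonicalMomentum φ q) =
      frame φ (φ q.1) (trivializedDμ (trivializedHamiltonian H) q.1 (momentum q)) := by
  have := FiniteDimensional.complete ℝ E
  have hK := ((contDiffAt_chartHamiltonian hφ hH (φ.map_source hq) (momentum q)).differentiableAt
    (by simp)).hasFDerivAt
  refine SeparatingDual.eq_iff_forall_dual_eq (R := ℝ) |>.2 fun β => ?_
  refine (apply_ofBidual _ _).trans ?_
  refine Eq.trans ?_ (apply_trivializedDμ hφ hH hq (momentum q) (β.comp (frame φ (φ q.1)))).symm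
  simp only [hamiltonian_ofCanonical]
  rw [momentum_eq hφ hq] at hK ⊢
  have h1 : HasFDerivAt (fun b : E →L[ℝ] ℝ => b.comp (frame φ (φ q.1)))
      ((ContinuousLinearMap.compL ℝ E E ℝ).flip (frame φ (φ q.1))) (canonicalMomentum φ q) :=
    ((ContinuousLinearMap.compL ℝ E E ℝ).flip (frame φ (φ q.1))).hasFDerivAt
  have h2 : HasFDerivAt (chartHamiltonian H φ ∘ fun b => (φ q.1, b.comp (frame φ (φ q.1)))) _
      (canonicalMomentum φ q) :=
    HasFDerivAt.comp _ hK ((hasFDerivAt_const (φ q.1) _).prodMk h1)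
  have h3 := DFunLike.congr_fun h2.fderiv β
  exact h3

/-- The second term appears because fixing `a` does not fix `μ = a ∘ frame φ x`: as `x` moves, the
momentum varies by `a ∘ D(frame)`, and pairing with `D_μh` gives its contribution. -/
theorem canonicalDg_apply {q : CotangentBundle E G} (hq : q.1 ∈ φ.source) (v : E) :
    canonicalDg H φ (φ q.1) (canonicalMomentum φ q) v =
      fderiv ℝ (chartHamiltonian H φ) (φ q.1, momentum q) (v, 0) +
      canonicalMomentum φ q (fderiv ℝ (frame φ) (φ q.1) v
        (trivializedDμ (trivializedHamiltonian H) q.1 (momentum q))) := by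
  have := FiniteDimensional.complete ℝ E
  have hK := ((contDiffAt_chartHamiltonian hφ hH (φ.map_source hq) (momentum q)).differentiableAt
    (by simp)).hasFDerivAt
  have hB : HasFDerivAt (frame φ) (fderiv ℝ (frame φ) (φ q.1)) (φ q.1) :=
    (((contDiffOn_frame hφ).contDiffAt
      (φ.open_target.mem_nhds (φ.map_source hq))).differentiableAt (by simp)).hasFDerivAt
  have h0 : canonicalMomentum φ q (fderiv ℝ (frame φ) (φ q.1) v
      (trivializedDμ (trivializedHamiltonian H) q.1 (momentum q))) =
      fderiv ℝ (chartHamiltonian H φ) (φ q.1, momentum q)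
        (0, (canonicalMomentum φ q).comp (fderiv ℝ (frame φ) (φ q.1) v)) :=
    apply_trivializedDμ hφ hH hq (momentum q)
      ((canonicalMomentum φ q).comp (fderiv ℝ (frame φ) (φ q.1) v))
  rw [h0, ← map_add]
  simp only [canonicalDg, hamiltonian_ofCanonical]
  rw [momentum_eq hφ hq] at hK ⊢
  have h1 : HasFDerivAt (fun y => (canonicalMomentum φ q).comp (frame φ y))
      ((ContinuousLinearMap.compL ℝ E E ℝ (canonicalMomentum φ q)).comp
        (fderiv ℝ (frame φ) (φ q.1))) (φ q.1) :=
    (ContinuousLinearMap.compL ℝ E E ℝ (canonicalMomentum φ q)).hasFDerivAt.comp (φ q.1) hB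
  have h2 : HasFDerivAt (chartHamiltonian H φ ∘ fun y =>
      (y, (canonicalMomentum φ q).comp (frame φ y))) _
      (φ q.1) :=
    HasFDerivAt.comp _ hK ((hasFDerivAt_id (φ q.1)).prodMk h1)
  refine (DFunLike.congr_fun h2.fderiv v).trans ?_
  simp

/-- Hamilton's equations in a chart at a time `t` are the Lie–Poisson equations at that time. -/
theorem hamilton_iff_liePoisson {T : ℝ} (hT : 0 < T) {γ : ℝ → CotangentBundle E G} {t : ℝ}
    (ht : t ∈ Icc 0 T)
    (hγ : ContMDiffWithinAt 𝓘(ℝ, ℝ) (𝓘(ℝ, E).prod 𝓘(ℝ, E →L[ℝ] ℝ)) ∞ γ (Icc 0 T) t)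
    (hs : (γ t).1 ∈ φ.source) :
    (HasDerivWithinAt (fun s => φ (γ s).1)
        (canonicalDp H φ (φ (γ t).1) (canonicalMomentum φ (γ t))) (Icc 0 T) t ∧
      HasDerivWithinAt (fun s => canonicalMomentum φ (γ s))
        (-canonicalDg H φ (φ (γ t).1) (canonicalMomentum φ (γ t))) (Icc 0 T) t) ↔
    (velocity T (fun s => (γ s).1) t = translate (γ t).1
        (trivializedDμ (trivializedHamiltonian H) (γ t).1 (momentum (γ t))) ∧
      HasDerivWithinAt (fun s => momentum (γ s))
        (-cotranslate (γ t).1 (trivializedDg (trivializedHamiltonian H) (γ t).1 (momentum (γ t))) +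
          coadjoint (trivializedDμ (trivializedHamiltonian H) (γ t).1 (momentum (γ t)))
            (momentum (γ t))) (Icc 0 T) t) := by
  have := FiniteDimensional.complete ℝ E
  have hu : UniqueDiffWithinAt ℝ (Icc 0 T) t := uniqueDiffOn_Icc hT t ht
  have hg := contMDiffWithinAt_fst hγ
  have hx := hasDerivWithinAt_chart_comp hφ hg hs
  have hμ := ((contMDiffWithinAt_momentum hγ).differentiableWithinAt (by simp)).hasDerivWithinAt
  have hB : HasFDerivAt (frame φ) (fderiv ℝ (frame φ) (φ (γ t).1)) (φ (γ t).1) :=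
    (((contDiffOn_frame hφ).contDiffAt
      (φ.open_target.mem_nhds (φ.map_source hs))).differentiableAt (by simp)).hasFDerivAt
  have hsrc : ∀ᶠ s in 𝓝[Icc 0 T] t, (γ s).1 ∈ φ.source :=
    hg.continuousWithinAt.preimage_mem_nhdsWithin (φ.open_source.mem_nhds hs)
  have hA : DifferentiableAt ℝ (coframe φ) (φ (γ t).1) :=
    ((contDiffOn_coframe hφ).contDiffAt
      (φ.open_target.mem_nhds (φ.map_source hs))).differentiableAt (by simp)
  -- Differentiability known in advance turns each derivative assertion below into an equation
  -- between vectors, by uniqueness of derivatives on `[0, T]`.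
  have ha : DifferentiableWithinAt ℝ (fun s => canonicalMomentum φ (γ s)) (Icc 0 T) t := by
    have h1 := ((contMDiffWithinAt_momentum hγ).differentiableWithinAt (by simp)).clm_comp
      (hA.comp_differentiableWithinAt t hx.differentiableWithinAt)
    refine h1.congr_of_eventuallyEq ?_ (canonicalMomentum_eq hφ hs)
    filter_upwards [hsrc] with s hs
    exact canonicalMomentum_eq hφ hs
  have ha' := ha.hasDerivWithinAt
  set q := γ t with hq
  set w : E := trivializedDμ (trivializedHamiltonian H) q.1 (momentum q) with hw
  set a' := derivWithin (fun s => canonicalMomentum φ (γ s)) (Icc 0 T) t with ha'_def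
  set x' := chartDeriv φ q.1 (velocity T (fun s => (γ s).1) t) with hx'
  have hBx : HasDerivWithinAt (fun s => frame φ (φ (γ s).1)) (fderiv ℝ (frame φ) (φ q.1) x')
      (Icc 0 T) t :=
    HasFDerivAt.comp_hasDerivWithinAt (l := frame φ) (f := fun s => φ (γ s).1) t hB hx
  have hμ' : HasDerivWithinAt (fun s => momentum (γ s))
      (a'.comp (frame φ (φ q.1)) + (canonicalMomentum φ q).comp (fderiv ℝ (frame φ) (φ q.1) x'))
      (Icc 0 T) t := by
    refine (ha'.clm_comp hBx).congr_of_eventuallyEq ?_ (momentum_eq hφ hs)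
    filter_upwards [hsrc] with s hs
    exact momentum_eq hφ hs
  have hvel : x' = frame φ (φ q.1) w ↔
      velocity T (fun s => (γ s).1) t = translate q.1 w := by
    rw [frame_apply, φ.left_inv hs]
    constructor
    · intro h
      exact (chartSymmDeriv_chartDeriv hφ hs _).symm.trans
        ((congrArg (chartSymmDeriv φ (φ q.1)) h).trans (chartSymmDeriv_chartDeriv hφ hs _))
    · intro h
      exact congrArg (chartDeriv φ q.1) h
  rw [canonicalDp_eq hφ hH hs, ← hvel]
  have e1 : HasDerivWithinAt (fun s => φ (γ s).1) (frame φ (φ q.1) w) (Icc 0 T) t ↔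
      x' = frame φ (φ q.1) w :=
    ⟨fun h => hu.eq_deriv _ hx h, fun h => h ▸ hx⟩
  rw [e1]
  -- The velocity `x'` enters the derivative of `μ`, so the momentum equations are compared only
  -- after the velocity equation has fixed `x'`.
  refine and_congr_right fun hxw => ?_
  have e2 : HasDerivWithinAt (fun s => canonicalMomentum φ (γ s))
      (-canonicalDg H φ (φ q.1) (canonicalMomentum φ q)) (Icc 0 T) t ↔
      a' = -canonicalDg H φ (φ q.1) (canonicalMomentum φ q) :=
    ⟨fun h => hu.eq_deriv _ ha' h, fun h => h ▸ ha'⟩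
  have e3 (ν : LieDual E G) : HasDerivWithinAt (fun s => momentum (γ s)) ν (Icc 0 T) t ↔
      a'.comp (frame φ (φ q.1)) + (canonicalMomentum φ q).comp
          (fderiv ℝ (frame φ) (φ q.1) x') = ν :=
    ⟨fun h => hu.eq_deriv _ hμ' h, fun h => h ▸ hμ'⟩
  rw [e2, e3, hxw]
  -- The structure equations split the coadjoint term into two derivatives of the frame. One cancels
  -- against the extra term of `canonicalDg_apply`; the other is the term that differentiating `a ∘
  -- frame` along the curve produces.
  have key (η : E) : (-cotranslate q.1 (trivializedDg (trivializedHamiltonian H) q.1 (momentum q)) +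
      coadjoint w (momentum q)) η = -canonicalDg H φ (φ q.1) (canonicalMomentum φ q)
        (frame φ (φ q.1) η) +
        canonicalMomentum φ q (fderiv ℝ (frame φ) (φ q.1) (frame φ (φ q.1) w) η) := by
    have h1 := cotranslate_trivializedDg hφ hH hs (momentum q) η
    have h2 := canonicalDg_apply hφ hH hs (frame φ (φ q.1) η)
    have h3 : coadjoint w (momentum q) η = canonicalMomentum φ q
        (frame φ (φ q.1) (adjointMap (G := G) w η)) :=
      DFunLike.congr_fun (momentum_eq hφ hs) (adjointMap (G := G) w η)
    rw [← fderiv_frame_sub hφ (φ.map_source hs), map_sub] at h3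
    rw [add_apply, neg_apply, h1, h2, h3]
    ring
  constructor
  · intro h
    ext η
    rw [key, h]
    simp
  · intro h
    ext v
    -- The frame is invertible, so every `v` is `frame η` for the test vector `η = coframe v`.
    have h1 := DFunLike.congr_fun h (coframe φ (φ q.1) v)
    rw [key] at h1
    have h2 := frame_coframe hφ (φ.map_source hs) v
    simp only [add_apply, ContinuousLinearMap.comp_apply, h2] at h1
    simpa using h1

-- The preferred chart at each point already yields the Lie–Poisson equations, which mention no
-- chart and so give back Hamilton's equations in every chart.
omit hφ in
theorem hamiltonEquations_iff_liePoissonEquations {T : ℝ} (hT : 0 < T) (g₀ : G) (μ₁ : LieDual E G)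
    {γ : ℝ → CotangentBundle E G}
    (hγ : ContMDiffOn 𝓘(ℝ, ℝ) (𝓘(ℝ, E).prod 𝓘(ℝ, E →L[ℝ] ℝ)) ∞ γ (Icc 0 T)) :
    HamiltonEquations H T g₀ μ₁ γ ↔ LiePoissonEquations (trivializedHamiltonian H) T g₀ μ₁
        (fun t => (γ t).1) (fun t => momentum (γ t)) := by
  constructor
  · rintro ⟨h1, h2, h3⟩
    have h (t) (ht : t ∈ Icc 0 T) := (hamilton_iff_liePoisson
      (IsManifold.chart_mem_maximalAtlas (I := 𝓘(ℝ, E)) (n := ∞) (γ t).1) hH hT ht (hγ t ht)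
      (mem_chart_source E (γ t).1)).1 (h1 _ (IsManifold.chart_mem_maximalAtlas _) t ht
        (mem_chart_source E (γ t).1))
    exact ⟨fun t ht => (h t ht).1, fun t ht => (h t ht).2, h2, (endpoint_iff _ _).1 h3⟩
  · rintro ⟨h1, h2, h3, h4⟩
    exact ⟨fun φ hφ t ht hs => (hamilton_iff_liePoisson hφ hH hT ht (hγ t ht) hs).2
      ⟨h1 t ht, h2 t ht⟩, h3, (endpoint_iff _ _).2 h4⟩

end Hamilton

/-! ### The Maurer–Cartan form along a map into `G`. -/

section MaurerCartan

variable {E : Type*} [NormedAddCommGroup E] [NormedSpace ℝ E]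
  {G : Type*} [TopologicalSpace G] [ChartedSpace E G] [Group G]
  {F : Type*} [NormedAddCommGroup F] [NormedSpace ℝ F]

/-- The pullback `f⁻¹ · Tf` of the left Maurer–Cartan form along a map `f` into `G`. -/
def maurerCartan (f : F → G) (s : Set F) (z : F) : F →L[ℝ] E :=
  let D : F →L[ℝ] E := mfderivWithin 𝓘(ℝ, F) 𝓘(ℝ, E) f s z
  (leftDerivInv (f z)).comp D

variable [LieGroup 𝓘(ℝ, E) ∞ G] {f : F → G} {s : Set F} {z : F}
  {φ : OpenPartialHomeomorph G E} (hφ : φ ∈ IsManifold.maximalAtlas 𝓘(ℝ, E) ∞ G)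

omit [Group G] [LieGroup 𝓘(ℝ, E) ∞ G] in
include hφ in
theorem contDiffWithinAt_chart_comp (hf : ContMDiffWithinAt 𝓘(ℝ, F) 𝓘(ℝ, E) ∞ f s z)
    (hz : f z ∈ φ.source) : ContDiffWithinAt ℝ ∞ (fun y => φ (f y)) s z :=
  (ContMDiffAt.comp_contMDiffWithinAt z (contMDiffAt_of_mem_maximalAtlas hφ hz)
    hf).contDiffWithinAt

include hφ in
theorem maurerCartan_eq (hf : ContMDiffWithinAt 𝓘(ℝ, F) 𝓘(ℝ, E) ∞ f s z)
    (hs : UniqueDiffWithinAt ℝ s z) (hz : f z ∈ φ.source) :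
    maurerCartan f s z =
      (coframe φ (φ (f z))).comp (fderivWithin ℝ (fun y => φ (f y)) s z) := by
  have h1 := (hf.mdifferentiableWithinAt (by simp)).hasMFDerivWithinAt
  have h2 := (hasMFDerivAt_chart hφ hz).comp_hasMFDerivWithinAt z h1
  let D : F →L[ℝ] E := mfderivWithin 𝓘(ℝ, F) 𝓘(ℝ, E) f s z
  have h3 : HasFDerivWithinAt (fun y => φ (f y)) ((chartDeriv φ (f z)).comp D) s z :=
    hasMFDerivWithinAt_iff_hasFDerivWithinAt.1 h2
  rw [h3.fderivWithin hs]
  ext v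
  change leftDerivInv (f z) (D v) = leftDerivInv (φ.symm (φ (f z)))
    (chartSymmDeriv φ (φ (f z)) (chartDeriv φ (f z) (D v)))
  rw [chartSymmDeriv_chartDeriv hφ hz, φ.left_inv hz]

theorem contDiffOn_maurerCartan [CompleteSpace E]
    (hf : ContMDiffOn 𝓘(ℝ, F) 𝓘(ℝ, E) ∞ f s) (hs : UniqueDiffOn ℝ s) :
    ContDiffOn ℝ ∞ (maurerCartan (E := E) f s) s := by
  intro z hz
  have hψ := IsManifold.chart_mem_maximalAtlas (I := 𝓘(ℝ, E)) (n := ∞) (f z)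
  have hx := mem_chart_source E (f z)
  have hsrc := (hf z hz).continuousWithinAt.preimage_mem_nhdsWithin
    ((chartAt E (f z)).open_source.mem_nhds hx)
  have h1 := contDiffWithinAt_chart_comp hψ (hf z hz) hx
  have h2 : ContDiffAt ℝ ∞ (coframe (chartAt E (f z))) (chartAt E (f z) (f z)) :=
    (contDiffOn_coframe hψ).contDiffAt ((chartAt E (f z)).open_target.mem_nhds
      ((chartAt E (f z)).map_source hx))
  have h3 := (h2.comp_contDiffWithinAt z h1).clm_comp
    (h1.fderivWithin_right (m := ∞) hs (by simp) hz)
  refine h3.congr_of_eventuallyEq ?_ (maurerCartan_eq hψ (hf z hz) (hs z hz) hx)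
  filter_upwards [hsrc, self_mem_nhdsWithin] with y hy hys
  exact maurerCartan_eq hψ (hf y hys) (hs y hys) hy

/-- The Maurer–Cartan equation. -/
theorem fderivWithin_maurerCartan_sub [FiniteDimensional ℝ E]
    (hf : ContMDiffOn 𝓘(ℝ, F) 𝓘(ℝ, E) ∞ f s) (hs : UniqueDiffOn ℝ s) (hz : z ∈ s)
    (hcl : z ∈ closure (interior s)) (u v : F) :
    fderivWithin ℝ (maurerCartan (E := E) f s) s z v u -
      fderivWithin ℝ (maurerCartan (E := E) f s) s z u v =
      adjointMap (G := G) (maurerCartan (E := E) f s z u) (maurerCartan (E := E) f s z v) := by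
  have := FiniteDimensional.complete ℝ E
  have hφ := IsManifold.chart_mem_maximalAtlas (I := 𝓘(ℝ, E)) (n := ∞) (f z)
  have hx := mem_chart_source E (f z)
  set φ := chartAt E (f z) with hφdef
  have hsrc := (hf z hz).continuousWithinAt.preimage_mem_nhdsWithin (φ.open_source.mem_nhds hx)
  have h1 := contDiffWithinAt_chart_comp hφ (hf z hz) hx
  -- The equation is the symmetry of the second derivative of `φ ∘ f`, rewritten through `D(φ ∘ f) =
  -- frame ∘ M`. The hypothesis `hcl` gives symmetry at boundary points of `s` too.
  have hsymm := h1.isSymmSndFDerivWithinAt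
    (by rw [minSmoothness_of_isRCLikeNormedField]; exact WithTop.coe_le_coe.2 le_top) hs hcl hz
  set M := maurerCartan (E := E) f s with hM
  have hfd (y) (hys : y ∈ s) (hy : f y ∈ φ.source) :
      fderivWithin ℝ (fun y => φ (f y)) s y = (frame φ (φ (f y))).comp (M y) := by
    rw [hM, maurerCartan_eq hφ (hf y hys) (hs y hys) hy]
    ext v
    exact (frame_coframe hφ (φ.map_source hy) _).symm
  have hB : HasFDerivAt (frame φ) (fderiv ℝ (frame φ) (φ (f z))) (φ (f z)) :=
    (((contDiffOn_frame hφ).contDiffAt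
      (φ.open_target.mem_nhds (φ.map_source hx))).differentiableAt (by simp)).hasFDerivAt
  have hMd : HasFDerivWithinAt M (fderivWithin ℝ M s z) s z :=
    ((contDiffOn_maurerCartan hf hs z hz).differentiableWithinAt (by simp)).hasFDerivWithinAt
  have hφf := (h1.differentiableWithinAt (by simp)).hasFDerivWithinAt
  have hBf : HasFDerivWithinAt (fun y => frame φ (φ (f y))) _ s z :=
    HasFDerivAt.comp_hasFDerivWithinAt (g := frame φ) (f := fun y => φ (f y)) z hB hφf
  have h2 : HasFDerivWithinAt (fderivWithin ℝ (fun y => φ (f y)) s) _ s z :=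
    (hBf.clm_comp hMd).congr_of_eventuallyEq (by
      filter_upwards [hsrc, self_mem_nhdsWithin] with y hy hys
      exact hfd y hys hy) (hfd z hz hx)
  have key (a b : F) : fderivWithin ℝ (fderivWithin ℝ (fun y => φ (f y)) s) s z a b =
      frame φ (φ (f z)) (fderivWithin ℝ M s z a b) +
      fderiv ℝ (frame φ) (φ (f z)) (frame φ (φ (f z)) (M z a)) (M z b) := by
    rw [h2.fderivWithin (hs z hz), hfd z hz hx]
    simp
  have h3 := hsymm.eq u v
  rw [key, key] at h3
  have h4 := fderiv_frame_sub hφ (φ.map_source hx) (M z u) (M z v)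
  have h5 : frame φ (φ (f z)) (fderivWithin ℝ M s z v u - fderivWithin ℝ M s z u v) =
      frame φ (φ (f z)) (adjointMap (G := G) (M z u) (M z v)) := by
    rw [← h4, map_sub, sub_eq_sub_iff_add_eq_add, ← h3, add_comm]
  -- Both sides have been compared after applying the frame, which the coframe cancels.
  have h6 := congrArg (coframe φ (φ (f z))) h5
  rwa [coframe_frame hφ (φ.map_source hx), coframe_frame hφ (φ.map_source hx)] at h6

omit [LieGroup 𝓘(ℝ, E) ∞ G] in
/-- Restriction of the Maurer–Cartan form along an affine slice. -/
theorem maurerCartan_comp {F' : Type*} [NormedAddCommGroup F'] [NormedSpace ℝ F']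
    (hf : ContMDiffWithinAt 𝓘(ℝ, F) 𝓘(ℝ, E) ∞ f s z) {j : F' → F} {j' : F' →L[ℝ] F} {s' : Set F'}
    {z' : F'} (hj : HasFDerivWithinAt j j' s' z') (hjz : j z' = z) (hjs : MapsTo j s' s)
    (hs' : UniqueDiffWithinAt ℝ s' z') :
    maurerCartan (E := E) (f ∘ j) s' z' = (maurerCartan f s z).comp j' := by
  subst hjz
  have h1 := (hf.mdifferentiableWithinAt (by simp)).hasMFDerivWithinAt
  have h2 := h1.comp z' hj.hasMFDerivWithinAt hjs
  have h3 := h2.mfderivWithin hs'.uniqueMDiffWithinAt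
  ext v
  exact congrArg (leftDerivInv (E := E) (f (j z'))) (DFunLike.congr_fun h3 v)

end MaurerCartan

/-! ### Calculus on the domain of a variation. -/

section Strip

/-- The domain `(-r, r) × [0, T]` of a variation. -/
def strip (r T : ℝ) : Set (ℝ × ℝ) := Ioo (-r) r ×ˢ Icc 0 T

variable {r T : ℝ} {V : Type*} [NormedAddCommGroup V] [NormedSpace ℝ V]

theorem uniqueDiffOn_strip (hT : 0 < T) : UniqueDiffOn ℝ (strip r T) :=
  isOpen_Ioo.uniqueDiffOn.prod (uniqueDiffOn_Icc hT)

/-- Makes the Maurer–Cartan equation available on the edges `t = 0` and `t = T`. -/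
theorem mem_closure_interior_strip (hT : 0 < T) {z : ℝ × ℝ} (hz : z ∈ strip r T) :
    z ∈ closure (interior (strip r T)) := by
  rw [strip, interior_prod_eq, interior_Icc, isOpen_Ioo.interior_eq, closure_prod_eq,
    closure_Ioo hT.ne]
  exact ⟨subset_closure hz.1, hz.2⟩

theorem hasFDerivWithinAt_slice_time (e t : ℝ) (s : Set ℝ) :
    HasFDerivWithinAt (fun t : ℝ => (e, t)) (ContinuousLinearMap.inr ℝ ℝ ℝ) s t :=
  (hasFDerivAt_prodMk_right e t).hasFDerivWithinAt

theorem hasFDerivWithinAt_slice_param (e t : ℝ) (s : Set ℝ) :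
    HasFDerivWithinAt (fun e : ℝ => (e, t)) (ContinuousLinearMap.inl ℝ ℝ ℝ) s e :=
  (hasFDerivAt_prodMk_left e t).hasFDerivWithinAt

theorem mapsTo_slice_time {e : ℝ} (he : e ∈ Ioo (-r) r) :
    MapsTo (fun t : ℝ => (e, t)) (Icc 0 T) (strip r T) := fun _ ht => ⟨he, ht⟩

theorem mapsTo_slice_param {t : ℝ} (ht : t ∈ Icc 0 T) :
    MapsTo (fun e : ℝ => (e, t)) (Ioo (-r) r) (strip r T) := fun _ he => ⟨he, ht⟩

variable {L : ℝ × ℝ → V} (hL : ContDiffOn ℝ ∞ L (strip r T))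
include hL

theorem hasDerivWithinAt_slice_time {e t : ℝ} (he : e ∈ Ioo (-r) r) (ht : t ∈ Icc 0 T) :
    HasDerivWithinAt (fun t => L (e, t)) (fderivWithin ℝ L (strip r T) (e, t) (0, 1))
      (Icc 0 T) t := by
  have h := ((hL (e, t) ⟨he, ht⟩).differentiableWithinAt (by simp)).hasFDerivWithinAt.comp t
    (hasFDerivWithinAt_slice_time e t (Icc 0 T)) (mapsTo_slice_time he)
  simpa [Function.comp_def] using h.hasDerivWithinAt

theorem hasDerivAt_slice_param {e t : ℝ} (he : e ∈ Ioo (-r) r) (ht : t ∈ Icc 0 T) :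
    HasDerivAt (fun e => L (e, t)) (fderivWithin ℝ L (strip r T) (e, t) (1, 0)) e := by
  have h := ((hL (e, t) ⟨he, ht⟩).differentiableWithinAt (by simp)).hasFDerivWithinAt.comp e
    (hasFDerivWithinAt_slice_param e t (Ioo (-r) r)) (mapsTo_slice_param ht)
  have h2 := h.hasDerivWithinAt.hasDerivAt (isOpen_Ioo.mem_nhds he)
  simpa [Function.comp_def] using h2

theorem continuousOn_fderivWithin_strip (hT : 0 < T) (u : ℝ × ℝ) :
    ContinuousOn (fun z => fderivWithin ℝ L (strip r T) z u) (strip r T) :=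
  (hL.continuousOn_fderivWithin (uniqueDiffOn_strip hT) (by simp)).clm_apply continuousOn_const

theorem continuousOn_fderivWithin_slice (hr : 0 < r) (hT : 0 < T) (u : ℝ × ℝ) :
    ContinuousOn (fun t => fderivWithin ℝ L (strip r T) (0, t) u) (Icc 0 T) :=
  (continuousOn_fderivWithin_strip hL hT u).comp (by fun_prop)
    (mapsTo_slice_time ⟨neg_lt_zero.2 hr, hr⟩)

/-- Differentiation under the integral sign for a smooth function on the strip. -/
theorem hasDerivAt_integral_strip (hr : 0 < r) (hT : 0 < T) :
    HasDerivAt (fun e => ∫ t in (0 : ℝ)..T, L (e, t))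
      (∫ t in (0 : ℝ)..T, fderivWithin ℝ L (strip r T) (0, t) (1, 0)) 0 := by
  have hc := continuousOn_fderivWithin_strip hL hT (1, 0)
  -- Halving the width leaves a compact rectangle inside the strip, on which the continuous
  -- parameter derivative has a uniform bound.
  have hsub : Icc (-(r / 2)) (r / 2) ×ˢ Icc 0 T ⊆ strip r T := by
    rintro ⟨e, t⟩ ⟨he, ht⟩
    simp only [mem_Icc] at he
    exact ⟨⟨by linarith, by linarith⟩, ht⟩
  obtain ⟨C, hC⟩ := (isCompact_Icc.prod isCompact_Icc).exists_bound_of_continuousOn (hc.mono hsub)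
  have hIoc : uIoc 0 T ⊆ Icc 0 T := by
    rw [uIoc_of_le hT.le]; exact Ioc_subset_Icc_self
  have hcont {e : ℝ} (he : e ∈ Ioo (-r) r) : ContinuousOn (fun t => L (e, t)) (Icc 0 T) :=
    hL.continuousOn.comp (by fun_prop) (mapsTo_slice_time he)
  have h0 : (0 : ℝ) ∈ Ioo (-r) r := ⟨neg_lt_zero.2 hr, hr⟩
  have hmem : Ioo (-(r / 2)) (r / 2) ∈ 𝓝 (0 : ℝ) := Ioo_mem_nhds (by linarith) (by linarith)
  refine (intervalIntegral.hasDerivAt_integral_of_dominated_loc_of_deriv_le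
    (F' := fun e t => fderivWithin ℝ L (strip r T) (e, t) (1, 0)) (bound := fun _ => C)
    hmem ?_ ?_ ?_ ?_ ?_ ?_).2
  · filter_upwards [isOpen_Ioo.mem_nhds h0] with e he
    exact ((hcont he).mono hIoc).aestronglyMeasurable measurableSet_uIoc
  · exact ContinuousOn.intervalIntegrable (by rw [uIcc_of_le hT.le]; exact hcont h0)
  · exact ((continuousOn_fderivWithin_slice hL hr hT _).mono hIoc).aestronglyMeasurable
      measurableSet_uIoc
  · refine .of_forall fun t ht e he => hC (e, t) ⟨Ioo_subset_Icc_self he, hIoc ht⟩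
  · exact intervalIntegrable_const
  · refine .of_forall fun t ht e he => hasDerivAt_slice_param hL ?_ (hIoc ht)
    exact ⟨by linarith [he.1], by linarith [he.2]⟩

theorem integral_fderivWithin_time [CompleteSpace V] (hr : 0 < r) (hT : 0 < T) :
    ∫ t in (0 : ℝ)..T, fderivWithin ℝ L (strip r T) (0, t) (0, 1) = L (0, T) - L (0, 0) := by
  have h0 : (0 : ℝ) ∈ Ioo (-r) r := ⟨neg_lt_zero.2 hr, hr⟩
  have h1 : ContDiffOn ℝ 1 (fun t => L (0, t)) (Icc 0 T) :=
    (hL.of_le (by exact WithTop.coe_le_coe.2 le_top)).comp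
      (contDiff_prodMk_right (0 : ℝ)).contDiffOn (mapsTo_slice_time h0)
  rw [← intervalIntegral.integral_derivWithin_Icc_of_contDiffOn_Icc h1 hT.le]
  refine intervalIntegral.integral_congr fun t ht => ?_
  rw [uIcc_of_le hT.le] at ht
  exact ((hasDerivWithinAt_slice_time hL h0 ht).derivWithin (uniqueDiffOn_Icc hT t ht)).symm

end Strip

/-! ### The first variation of the left-trivialized action. -/

section FirstVariation

variable {E : Type*} [NormedAddCommGroup E] [NormedSpace ℝ E] [FiniteDimensional ℝ E]
  {G : Type*} [TopologicalSpace G] [ChartedSpace E G] [Group G] [LieGroup 𝓘(ℝ, E) ∞ G]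

/-- The derivative `D_μh`, as a vector of the model space. -/
def momentumDeriv (h : G → LieDual E G → ℝ) (g : G) (μ : LieDual E G) : E := trivializedDμ h g μ

/-- The integrand of the first variation after integration by parts, for the variation `η` of the
position and the variation `ν` of the momentum. -/
def eulerResidual (h : G → LieDual E G → ℝ) (T : ℝ) (g : ℝ → G) (μ : ℝ → LieDual E G) (t : ℝ)
    (η : E) (ν : LieDual E G) : ℝ :=
  ν (maurerCartan (E := E) g (Icc 0 T) t 1) - ν (momentumDeriv h (g t) (μ t)) -
    (derivWithin μ (Icc 0 T) t - coadjoint (maurerCartan (E := E) g (Icc 0 T) t 1) (μ t) +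
      cotranslate (g t) (trivializedDg h (g t) (μ t))) η

variable {H : CotangentBundle E G → ℝ}
  (hH : ContMDiff (𝓘(ℝ, E).prod 𝓘(ℝ, E →L[ℝ] ℝ)) 𝓘(ℝ, ℝ) ∞ H)
include hH

/-- The chain rule in left-trivialized form: in a chart, the frame in `g* · D_gh` cancels the
coframe in the Maurer–Cartan form. -/
theorem fderivWithin_trivializedHamiltonian {F : Type*} [NormedAddCommGroup F] [NormedSpace ℝ F]
    {s : Set F} {z : F} {g : F → G} {μ : F → LieDual E G} (hs : UniqueDiffWithinAt ℝ s z)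
    (hg : ContMDiffWithinAt 𝓘(ℝ, F) 𝓘(ℝ, E) ∞ g s z) (hμ : ContDiffWithinAt ℝ ∞ μ s z) (u : F) :
    fderivWithin ℝ (fun y => trivializedHamiltonian H (g y) (μ y)) s z u =
      cotranslate (g z) (trivializedDg (trivializedHamiltonian H) (g z) (μ z))
        (maurerCartan (E := E) g s z u) +
      fderivWithin ℝ μ s z u (momentumDeriv (trivializedHamiltonian H) (g z) (μ z)) := by
  have := FiniteDimensional.complete ℝ E
  have hφ := IsManifold.chart_mem_maximalAtlas (I := 𝓘(ℝ, E)) (n := ∞) (g z)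
  have hx := mem_chart_source E (g z)
  set φ := chartAt E (g z) with hφdef
  have hsrc := hg.continuousWithinAt.preimage_mem_nhdsWithin (φ.open_source.mem_nhds hx)
  have hK := ((contDiffAt_chartHamiltonian hφ hH (φ.map_source hx) (μ z)).differentiableAt
    (by simp)).hasFDerivAt
  have h1 := ((contDiffWithinAt_chart_comp hφ hg hx).differentiableWithinAt
    (by simp)).hasFDerivWithinAt
  have h2 := (hμ.differentiableWithinAt (by simp)).hasFDerivWithinAt
  have h3 : HasFDerivWithinAt (fun y => chartHamiltonian H φ (φ (g y), μ y)) _ s z :=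
    HasFDerivAt.comp_hasFDerivWithinAt (f := fun y => (φ (g y), μ y)) z hK (h1.prodMk h2)
  have h4 : HasFDerivWithinAt (fun y => trivializedHamiltonian H (g y) (μ y)) _ s z :=
    h3.congr_of_eventuallyEq (by
      filter_upwards [hsrc] with y hy
      simp only [chartHamiltonian]
      rw [φ.left_inv hy]) (by simp only [chartHamiltonian]; rw [φ.left_inv hx])
  rw [h4.fderivWithin hs, cotranslate_trivializedDg hφ hH hx, momentumDeriv,
    apply_trivializedDμ hφ hH hx,
    maurerCartan_eq hφ hg hs hx, ← map_add]
  simp only [ContinuousLinearMap.comp_apply, frame_coframe hφ (φ.map_source hx)]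
  simp

variable {r T : ℝ} {g : ℝ → ℝ → G} {μ : ℝ → ℝ → LieDual E G}

/-- The integrand of the left-trivialized action along a family of curves. -/
def familyLagrangian (H : CotangentBundle E G → ℝ) (r T : ℝ) (g : ℝ → ℝ → G)
    (μ : ℝ → ℝ → LieDual E G) (z : ℝ × ℝ) : ℝ :=
  μ z.1 z.2 (maurerCartan (E := E) (fun x : ℝ × ℝ => g x.1 x.2) (strip r T) z (0, 1)) -
    trivializedHamiltonian H (g z.1 z.2) (μ z.1 z.2)

/-- The pairing `⟨μ, η⟩` along a family of curves. -/
def familyPairing (r T : ℝ) (g : ℝ → ℝ → G) (μ : ℝ → ℝ → LieDual E G) (z : ℝ × ℝ) : ℝ :=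
  μ z.1 z.2 (maurerCartan (E := E) (fun x : ℝ × ℝ => g x.1 x.2) (strip r T) z (1, 0))

variable (hr : 0 < r) (hT : 0 < T)
  (hg : ContMDiffOn 𝓘(ℝ, ℝ × ℝ) 𝓘(ℝ, E) ∞ (fun x : ℝ × ℝ => g x.1 x.2) (strip r T))
  (hμ : ContDiffOn ℝ ∞ (fun x : ℝ × ℝ => μ x.1 x.2) (strip r T))

-- Together with `trivializedVariation_eq`, this makes `ξ` and `η` the two components of a single
-- form on the strip, to which the Maurer–Cartan equation applies.
omit hH [FiniteDimensional ℝ E] [LieGroup 𝓘(ℝ, E) ∞ G] in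
include hg hT in
theorem maurerCartan_slice_time {e t : ℝ} (he : e ∈ Ioo (-r) r) (ht : t ∈ Icc 0 T) :
    maurerCartan (E := E) (g e) (Icc 0 T) t 1 =
      maurerCartan (E := E) (fun x : ℝ × ℝ => g x.1 x.2) (strip r T) (e, t) (0, 1) := by
  have h := maurerCartan_comp (hg (e, t) ⟨he, ht⟩) (hasFDerivWithinAt_slice_time e t (Icc 0 T)) rfl
    (mapsTo_slice_time he) (uniqueDiffOn_Icc hT t ht)
  simpa [Function.comp_def] using! DFunLike.congr_fun h 1

omit hH [FiniteDimensional ℝ E] [LieGroup 𝓘(ℝ, E) ∞ G] in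
include hg hr in
theorem trivializedVariation_eq {t : ℝ} (ht : t ∈ Icc 0 T) :
    (trivializedVariation (E := E) g t : E) =
      maurerCartan (E := E) (fun x : ℝ × ℝ => g x.1 x.2) (strip r T) (0, t) (1, 0) := by
  have h0 : (0 : ℝ) ∈ Ioo (-r) r := ⟨neg_lt_zero.2 hr, hr⟩
  have h := maurerCartan_comp (hg (0, t) ⟨h0, ht⟩) (hasFDerivWithinAt_slice_param 0 t (Ioo (-r) r))
    rfl (mapsTo_slice_param ht) (isOpen_Ioo.uniqueDiffOn 0 h0)
  have h2 := DFunLike.congr_fun h 1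
  have h3 : maurerCartan (E := E) (fun e => g e t) (Ioo (-r) r) 0 1 = trivializedVariation g t := by
    simp only [maurerCartan, mfderivWithin_of_mem_nhds (isOpen_Ioo.mem_nhds h0)]
    rfl
  rw [← h3]
  simpa [Function.comp_def] using! h2

include hg hμ hT

theorem contDiffOn_familyLagrangian : ContDiffOn ℝ ∞ (familyLagrangian H r T g μ) (strip r T) := by
  have := FiniteDimensional.complete ℝ E
  refine (hμ.clm_apply ((contDiffOn_maurerCartan hg (uniqueDiffOn_strip hT)).clm_apply
    contDiffOn_const)).sub fun z hz => ?_
  exact contDiffWithinAt_trivializedHamiltonian hH (hg z hz) (hμ z hz)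

omit hH in
theorem contDiffOn_familyPairing : ContDiffOn ℝ ∞ (familyPairing r T g μ) (strip r T) := by
  have := FiniteDimensional.complete ℝ E
  exact hμ.clm_apply ((contDiffOn_maurerCartan hg (uniqueDiffOn_strip hT)).clm_apply
    contDiffOn_const)

include hr

/-- The pointwise first variation formula. -/
theorem fderivWithin_familyLagrangian {t : ℝ} (ht : t ∈ Icc 0 T) :
    fderivWithin ℝ (familyLagrangian H r T g μ) (strip r T) (0, t) (1, 0) =
      fderivWithin ℝ (familyPairing r T g μ) (strip r T) (0, t) (0, 1) +
      eulerResidual (trivializedHamiltonian H) T (g 0) (μ 0) t (trivializedVariation (E := E) g t)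
        (deriv (fun e => μ e t) 0) := by
  have := FiniteDimensional.complete ℝ E
  have h0 : (0 : ℝ) ∈ Ioo (-r) r := ⟨neg_lt_zero.2 hr, hr⟩
  have hz : ((0 : ℝ), t) ∈ strip r T := ⟨h0, ht⟩
  have hS := uniqueDiffOn_strip (r := r) hT
  have hu := hS _ hz
  rw [trivializedVariation_eq hr hg ht, eulerResidual, maurerCartan_slice_time hT hg h0 ht,
    (hasDerivAt_slice_param hμ h0 ht).deriv,
    (hasDerivWithinAt_slice_time hμ h0 ht).derivWithin (uniqueDiffOn_Icc hT t ht)]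
  have hMC := fderivWithin_maurerCartan_sub hg hS hz (mem_closure_interior_strip hT hz) (0, 1)
      (1, 0)
  have hM := ((contDiffOn_maurerCartan hg hS _ hz).differentiableWithinAt
      (by simp)).hasFDerivWithinAt
  have hμ' := ((hμ _ hz).differentiableWithinAt (by simp)).hasFDerivWithinAt
  have hh := ((contDiffWithinAt_trivializedHamiltonian hH (hg _ hz)
      (hμ _ hz)).differentiableWithinAt
    (by simp)).hasFDerivWithinAt
  have hh' := fderivWithin_trivializedHamiltonian hH hu (hg _ hz) (hμ _ hz) (1, 0)
  have hL : HasFDerivWithinAt (familyLagrangian H r T g μ) _ (strip r T) (0, t) :=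
    (hμ'.clm_apply (hM.clm_apply (hasFDerivWithinAt_const ((0 : ℝ), (1 : ℝ)) _ _))).sub hh
  have hP : HasFDerivWithinAt (familyPairing r T g μ) _ (strip r T) (0, t) :=
    hμ'.clm_apply (hM.clm_apply (hasFDerivWithinAt_const ((1 : ℝ), (0 : ℝ)) _ _))
  rw [hL.fderivWithin hu, hP.fderivWithin hu]
  set M := maurerCartan (E := E) (fun x : ℝ × ℝ => g x.1 x.2) (strip r T)
  -- This is `∂_ε ξ = ∂_t η + [ξ, η]`: it trades the variation of the velocity for a time derivative
  -- of `η`, leaving a bracket that becomes the coadjoint term.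
  have hMC' : fderivWithin ℝ M (strip r T) (0, t) (1, 0) (0, 1) =
      fderivWithin ℝ M (strip r T) (0, t) (0, 1) (1, 0) +
        adjointMap (G := G) (M (0, t) (0, 1)) (M (0, t) (1, 0)) := by
    rw [← hMC]; abel
  have hco : coadjoint (G := G) (M (0, t) (0, 1)) (μ 0 t) (M (0, t) (1, 0)) =
    μ 0 t (adjointMap (G := G) (M (0, t) (0, 1)) (M (0, t) (1, 0))) := rfl
  simp [hh', hMC', hco]
  ring

/-- The first variation of the left-trivialized action. -/
theorem hasDerivAt_trivializedAction :
    HasDerivAt (fun e => trivializedAction (trivializedHamiltonian H) T (g e) (μ e))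
      (μ 0 T (trivializedVariation (E := E) g T) - μ 0 0 (trivializedVariation (E := E) g 0) +
        ∫ t in (0 : ℝ)..T, eulerResidual (trivializedHamiltonian H) T (g 0) (μ 0) t
          (trivializedVariation (E := E) g t) (deriv (fun e => μ e t) 0)) 0 := by
  have h0 : (0 : ℝ) ∈ Ioo (-r) r := ⟨neg_lt_zero.2 hr, hr⟩
  have hL := contDiffOn_familyLagrangian hH hT hg hμ
  have hP := contDiffOn_familyPairing hT hg hμ
  have h1 := hasDerivAt_integral_strip hL hr hT
  have h2 : ∫ t in (0 : ℝ)..T, fderivWithin ℝ (familyLagrangian H r T g μ) (strip r T) (0, t)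
      (1, 0) =
      μ 0 T (trivializedVariation (E := E) g T) - μ 0 0 (trivializedVariation (E := E) g 0) +
        ∫ t in (0 : ℝ)..T, eulerResidual (trivializedHamiltonian H) T (g 0) (μ 0) t
          (trivializedVariation (E := E) g t) (deriv (fun e => μ e t) 0) := by
    have hint {V : Type} [NormedAddCommGroup V] {f : ℝ → V} (hf : ContinuousOn f (Icc 0 T)) :
        IntervalIntegrable f MeasureTheory.volume 0 T :=
      ContinuousOn.intervalIntegrable (by rwa [uIcc_of_le hT.le])
    -- The total time derivative of `⟨μ, η⟩` integrates to the two boundary pairings.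
    have e1 := integral_fderivWithin_time hP hr hT
    rw [trivializedVariation_eq hr hg ⟨hT.le, le_rfl⟩, trivializedVariation_eq hr hg
        ⟨le_rfl, hT.le⟩]
    refine Eq.trans ?_ (congrArg (· + _) e1)
    rw [← sub_eq_iff_eq_add', ← intervalIntegral.integral_sub
      (hint (continuousOn_fderivWithin_slice hL hr hT _))
      (hint (continuousOn_fderivWithin_slice hP hr hT _))]
    refine intervalIntegral.integral_congr fun t ht => ?_
    rw [uIcc_of_le hT.le] at ht
    simp only [fderivWithin_familyLagrangian hH hr hT hg hμ ht, add_sub_cancel_left]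
  rw [← h2]
  refine h1.congr_of_eventuallyEq ?_
  filter_upwards [isOpen_Ioo.mem_nhds h0] with e he
  refine intervalIntegral.integral_congr fun t ht => ?_
  rw [uIcc_of_le hT.le] at ht
  simp only [familyLagrangian, ← maurerCartan_slice_time hT hg he ht]
  rfl

/-- By the pointwise formula the residual is a difference of two derivatives of smooth functions on
the strip. -/
theorem continuousOn_eulerResidual :
    ContinuousOn (fun t => eulerResidual (trivializedHamiltonian H) T (g 0) (μ 0) t
      (trivializedVariation (E := E) g t) (deriv (fun e => μ e t) 0)) (Icc 0 T) := by
  refine ((continuousOn_fderivWithin_slice (contDiffOn_familyLagrangian hH hT hg hμ) hr hT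
      (1, 0)).sub
    (continuousOn_fderivWithin_slice (contDiffOn_familyPairing hT hg hμ) hr hT (0, 1))).congr ?_
  intro t ht
  simp only [Pi.sub_apply, fderivWithin_familyLagrangian hH hr hT hg hμ ht, add_sub_cancel_left]

end FirstVariation

/-! ### From the trivialized principle to the Lie–Poisson equations and back. -/

section EulerLagrange

variable {E : Type*} [NormedAddCommGroup E] [NormedSpace ℝ E] [FiniteDimensional ℝ E]
  {G : Type*} [TopologicalSpace G] [ChartedSpace E G] [Group G] [LieGroup 𝓘(ℝ, E) ∞ G]

omit [FiniteDimensional ℝ E] [LieGroup 𝓘(ℝ, E) ∞ G] in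
theorem maurerCartan_congr {F : Type*} [NormedAddCommGroup F] [NormedSpace ℝ F] {f f' : F → G}
    {s : Set F} {z : F} (h : ∀ y ∈ s, f' y = f y) (hz : z ∈ s) :
    maurerCartan (E := E) f' s z = maurerCartan f s z := by
  have h1 := mfderivWithin_congr (I := 𝓘(ℝ, F)) (I' := 𝓘(ℝ, E)) h (h z hz)
  ext v
  have h2 : (mfderivWithin 𝓘(ℝ, F) 𝓘(ℝ, E) f' s z v : E) = mfderivWithin 𝓘(ℝ, F) 𝓘(ℝ, E) f s z v :=
    DFunLike.congr_fun h1 v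
  change leftDerivInv (E := E) (f' z) _ = leftDerivInv (E := E) (f z) _
  rw [h z hz]
  exact congrArg (leftDerivInv (E := E) (f z)) h2

/-- A variation agrees with its base curve at `ε = 0` only on `[0, T]`; the derivatives in the
residual are taken within that interval. -/
theorem eulerResidual_congr (h : G → LieDual E G → ℝ) {T : ℝ} {g g' : ℝ → G}
    {μ μ' : ℝ → LieDual E G} (hg : ∀ t ∈ Icc 0 T, g' t = g t) (hμ : ∀ t ∈ Icc 0 T, μ' t = μ t)
    {t : ℝ} (ht : t ∈ Icc 0 T) (η : E) (ν : LieDual E G) :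
    eulerResidual h T g' μ' t η ν = eulerResidual h T g μ t η ν := by
  rw [eulerResidual, eulerResidual, maurerCartan_congr hg ht, derivWithin_congr hμ (hμ t ht),
    hg t ht, hμ t ht]

theorem eulerResidual_smul (h : G → LieDual E G → ℝ) (T : ℝ) (g : ℝ → G) (μ : ℝ → LieDual E G)
    (t c : ℝ) (η : E) (ν : LieDual E G) :
    eulerResidual h T g μ t (c • η) (c • ν) = c • eulerResidual h T g μ t η ν := by
  simp only [eulerResidual, map_smul, smul_apply, smul_eq_mul]
  ring

/-- The residual is linear in the independent pair `(η, ν)`: taking `η = 0` isolates the velocity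
equation, and taking `ν = 0` then isolates the momentum equation. -/
theorem eulerResidual_eq_zero_iff {h : G → LieDual E G → ℝ} {T : ℝ} (hT : 0 < T) {g : ℝ → G}
    {μ : ℝ → LieDual E G} {t : ℝ} (ht : t ∈ Icc 0 T) (hμ : DifferentiableWithinAt ℝ μ (Icc 0 T) t) :
    (∀ η ν, eulerResidual h T g μ t η ν = 0) ↔
      velocity T g t = translate (g t) (trivializedDμ h (g t) (μ t)) ∧
      HasDerivWithinAt μ (-cotranslate (g t) (trivializedDg h (g t) (μ t)) +
        coadjoint (trivializedDμ h (g t) (μ t)) (μ t)) (Icc 0 T) t := by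
  set w : E := momentumDeriv h (g t) (μ t) with hw
  have hv : velocity T g t = translate (g t) (trivializedDμ h (g t) (μ t)) ↔ maurerCartan (E := E) g
      (Icc 0 T) t 1 = w := by
    constructor
    · intro h1
      exact (congrArg (leftDerivInv (E := E) (g t)) h1).trans (leftDerivInv_leftDeriv _ _)
    · intro h1
      exact (leftDeriv_leftDerivInv (E := E) _ _).symm.trans
          (congrArg (leftDeriv (E := E) (g t)) h1)
  rw [hv]
  have hd (ν : LieDual E G) : HasDerivWithinAt μ ν (Icc 0 T) t ↔ derivWithin μ (Icc 0 T) t = ν :=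
    ⟨fun h1 => h1.derivWithin (uniqueDiffOn_Icc hT t ht), fun h1 => h1 ▸ hμ.hasDerivWithinAt⟩
  rw [hd, show trivializedDμ h (g t) (μ t) = w from rfl]
  constructor
  · intro h0
    have h1 : maurerCartan (E := E) g (Icc 0 T) t 1 = w := by
      refine SeparatingDual.eq_iff_forall_dual_eq (R := ℝ) |>.2 fun ν => ?_
      have := h0 0 ν
      rw [eulerResidual, map_zero, sub_zero, sub_eq_zero] at this
      exact this
    refine ⟨h1, ?_⟩
    ext η
    have := h0 η 0
    rw [eulerResidual, h1] at this
    simp only [zero_apply, sub_apply, add_apply, neg_apply] at this ⊢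
    linarith
  · rintro ⟨h1, h2⟩ η ν
    rw [eulerResidual, h1, h2, ← hw]
    simp

section Variation

variable {T : ℝ} {g : ℝ → G} {μ : ℝ → LieDual E G}

omit [FiniteDimensional ℝ E] in
theorem trivializedVariation_mul {q : ℝ → ℝ → G} {t : ℝ} (hq : q 0 t = 1) {D : ℝ →L[ℝ] E}
    (h : HasMFDerivAt 𝓘(ℝ, ℝ) 𝓘(ℝ, E) (fun e => q e t) 0 D) :
    (trivializedVariation (E := E) (fun e t => g t * q e t) t : E) = D 1 := by
  have h1 := hasMFDerivAt_mul_left_one (E := E) (g t)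
  rw [← hq] at h1
  have h2 := DFunLike.congr_fun (HasMFDerivAt.comp (0 : ℝ) h1 h).mfderiv 1
  have h3 : (trivializedVariation (E := E) (fun e t => g t * q e t) t : E) =
      leftDerivInv (E := E) (g t * q 0 t) (leftDeriv (E := E) (g t) (D 1)) :=
    congrArg (leftDerivInv (E := E) (g t * q 0 t)) h2
  rw [h3, hq, mul_one, leftDerivInv_leftDeriv]

/-- The point of `G` with coordinate `x` relative to the identity in the preferred chart at the
identity. -/
def nearOne (x : E) : G := (chartAt E (1 : G)).symm (chartAt E (1 : G) 1 + x)

omit [LieGroup 𝓘(ℝ, E) ∞ G] [NormedSpace ℝ E] [FiniteDimensional ℝ E] in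
theorem nearOne_zero : nearOne (G := G) (0 : E) = 1 := by
  rw [nearOne, add_zero]
  exact (chartAt E (1 : G)).left_inv (mem_chart_source E 1)

omit [FiniteDimensional ℝ E] in
theorem hasMFDerivAt_nearOne : HasMFDerivAt 𝓘(ℝ, E) 𝓘(ℝ, E) (nearOne (G := G) (E := E)) 0
    (ContinuousLinearMap.id ℝ E) := by
  have h1 := hasMFDerivAt_chartAt_symm_self (E := E) (1 : G)
  have h2 : HasMFDerivAt 𝓘(ℝ, E) 𝓘(ℝ, E) (fun x => chartAt E (1 : G) 1 + x) 0
      (ContinuousLinearMap.id ℝ E) := ((hasFDerivAt_id (0 : E)).const_add _).hasMFDerivAt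
  rw [← add_zero (chartAt E (1 : G) 1)] at h1
  have h3 := HasMFDerivAt.comp (0 : E) h1 h2
  exact h3

omit [FiniteDimensional ℝ E] in
theorem exists_contMDiffOn_nearOne :
    ∃ δ > 0, ContMDiffOn 𝓘(ℝ, E) 𝓘(ℝ, E) ∞ (nearOne (G := G) (E := E)) (Metric.ball 0 δ) := by
  have h1 := (chartAt E (1 : G)).open_target.mem_nhds
    ((chartAt E (1 : G)).map_source (mem_chart_source E 1))
  obtain ⟨δ, hδ, hsub⟩ := Metric.mem_nhds_iff.1 h1
  refine ⟨δ, hδ, ?_⟩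
  have h2 : ContMDiff 𝓘(ℝ, E) 𝓘(ℝ, E) ∞ (fun x => chartAt E (1 : G) 1 + x) :=
    (contDiff_const.add contDiff_id).contMDiff
  refine (contMDiffOn_symm_of_mem_maximalAtlas (IsManifold.chart_mem_maximalAtlas (1 : G))).comp
    h2.contMDiffOn fun x hx => hsub ?_
  simpa [dist_eq_norm] using hx

omit [FiniteDimensional ℝ E] in
/-- The variation of a curve with prescribed infinitesimal generator `χ(t) v` and momentum
variation `χ(t) ν`. -/
theorem exists_variation (hT : 0 < T) (hg : ContMDiffOn 𝓘(ℝ, ℝ) 𝓘(ℝ, E) ∞ g (Icc 0 T))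
    (hμ : ContDiffOn ℝ ∞ μ (Icc 0 T)) {χ : ℝ → ℝ} (hχ : ContDiff ℝ ∞ χ) (v : E)
    (ν : LieDual E G) :
    ∃ (gv : ℝ → ℝ → G) (μv : ℝ → ℝ → LieDual E G), gv 0 = g ∧ μv 0 = μ ∧
      (∃ r > 0, ContMDiffOn 𝓘(ℝ, ℝ × ℝ) 𝓘(ℝ, E) ∞ (fun x : ℝ × ℝ => gv x.1 x.2) (strip r T) ∧
        ContDiffOn ℝ ∞ (fun x : ℝ × ℝ => μv x.1 x.2) (strip r T)) ∧
      ∀ t, (trivializedVariation (E := E) gv t : E) = χ t • v ∧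
        deriv (fun e => μv e t) 0 = χ t • ν := by
  -- Right multiplication of `g t` by a curve leaving the identity with velocity `χ t • v` makes `η`
  -- equal to that velocity.
  refine ⟨fun e t => g t * nearOne ((e * χ t) • v), fun e t => μ t + (e * χ t) • ν, ?_, ?_, ?_, ?_⟩
  · ext t
    simp [nearOne_zero]
  · ext t
    simp
  · obtain ⟨δ, hδ, hn⟩ := exists_contMDiffOn_nearOne (E := E) (G := G)
    obtain ⟨C, hC⟩ := isCompact_Icc.exists_bound_of_continuousOn
        (hχ.continuous.continuousOn (s := Icc 0 T))
    have hC0 : 0 ≤ C := (norm_nonneg _).trans (hC 0 ⟨le_rfl, hT.le⟩)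
    have hp : 0 < C * ‖v‖ + 1 := by positivity
    have hsnd : MapsTo Prod.snd (strip (δ / (C * ‖v‖ + 1)) T) (Icc 0 T) := fun x hx => hx.2
    -- With `|χ| ≤ C` on `[0, T]`, this radius keeps `(e * χ t) • v` in the ball where `nearOne` is
    -- smooth; the `+ 1` covers a vanishing product `C * ‖v‖`.
    refine ⟨δ / (C * ‖v‖ + 1), div_pos hδ hp, ?_, ?_⟩
    · have h1 : ContMDiffOn 𝓘(ℝ, ℝ × ℝ) 𝓘(ℝ, E) ∞ (fun x : ℝ × ℝ => g x.2)
          (strip (δ / (C * ‖v‖ + 1)) T) :=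
        hg.comp contDiff_snd.contMDiff.contMDiffOn hsnd
      have h2 : ContDiff ℝ ∞ (fun x : ℝ × ℝ => (x.1 * χ x.2) • v) :=
        (contDiff_fst.mul (hχ.comp contDiff_snd)).smul contDiff_const
      refine h1.mul (hn.comp h2.contMDiff.contMDiffOn ?_)
      rintro ⟨e, t⟩ ⟨he, ht⟩
      have h3 : |e| < δ / (C * ‖v‖ + 1) := abs_lt.2 he
      rw [lt_div_iff₀ hp] at h3
      have h4 : |χ t| ≤ C := hC t ht
      simp only [mem_preimage, mem_ball_zero_iff, norm_smul, norm_mul, Real.norm_eq_abs]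
      calc |e| * |χ t| * ‖v‖ ≤ |e| * C * ‖v‖ := by gcongr
        _ ≤ |e| * (C * ‖v‖ + 1) := by nlinarith [abs_nonneg e]
        _ < δ := h3
    · have h2 : ContDiff ℝ ∞ (fun x : ℝ × ℝ => (x.1 * χ x.2) • ν) :=
        (contDiff_fst.mul (hχ.comp contDiff_snd)).smul contDiff_const
      exact (hμ.comp contDiff_snd.contDiffOn hsnd).add h2.contDiffOn
  · intro t
    constructor
    · have h1 : HasDerivAt (fun e : ℝ => (e * χ t) • v) (χ t • v) 0 := by
        simpa using ((hasDerivAt_id (0 : ℝ)).mul_const (χ t)).smul_const v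
      have h2 := hasMFDerivAt_nearOne (E := E) (G := G)
      have e0 : (0 : E) = ((0 : ℝ) * χ t) • v := by simp
      rw [e0] at h2
      have h3 := HasMFDerivAt.comp (0 : ℝ) h2 h1.hasFDerivAt.hasMFDerivAt
      have h4 := trivializedVariation_mul (E := E) (g := g)
        (q := fun e t => nearOne ((e * χ t) • v)) (t := t) (by simp [nearOne_zero]) h3
      exact h4.trans (one_smul ℝ (χ t • v))
    · have h1 : HasDerivAt (fun e : ℝ => μ t + (e * χ t) • ν) (χ t • ν) 0 := by
        simpa using (((hasDerivAt_id (0 : ℝ)).mul_const (χ t)).smul_const ν).const_add (μ t)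
      exact h1.deriv

end Variation

/-- The fundamental lemma of the calculus of variations on a compact interval. -/
theorem eqOn_zero_of_integral_mul_eq_zero {T : ℝ} (hT : 0 < T) {f : ℝ → ℝ}
    (hf : ContinuousOn f (Icc 0 T))
    (h : ∀ χ : ℝ → ℝ, ContDiff ℝ ∞ χ → tsupport χ ⊆ Ioo 0 T →
      ∫ t in (0 : ℝ)..T, χ t • f t = 0) : ∀ t ∈ Icc 0 T, f t = 0 := by
  have h1 : ∀ᵐ t, t ∈ Ioo 0 T → f t = 0 := by
    refine isOpen_Ioo.ae_eq_zero_of_integral_contDiff_smul_eq_zero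
      ((hf.mono Ioo_subset_Icc_self).locallyIntegrableOn measurableSet_Ioo) fun χ hχ _ hs => ?_
    rw [← h χ hχ hs, intervalIntegral.integral_eq_integral_of_support_subset]
    intro t ht
    exact Ioo_subset_Ioc_self (hs (subset_tsupport χ (left_ne_zero_of_smul ht)))
  -- The end points are a null set, so the almost-everywhere statement extends to `[0, T]` and
  -- continuity upgrades it to every point.
  have h2 : f =ᵐ[MeasureTheory.volume.restrict (Icc 0 T)] fun _ => 0 := by
    rw [MeasureTheory.restrict_Ioo_eq_restrict_Icc.symm]
    exact (MeasureTheory.ae_restrict_iff' measurableSet_Ioo).2 h1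
  exact MeasureTheory.Measure.eqOn_Icc_of_ae_eq _ hT.ne h2 hf continuousOn_const

variable {H : CotangentBundle E G → ℝ}
  (hH : ContMDiff (𝓘(ℝ, E).prod 𝓘(ℝ, E →L[ℝ] ℝ)) 𝓘(ℝ, ℝ) ∞ H)

include hH in
theorem trivializedDAlembert_iff_liePoisson {T : ℝ} (hT : 0 < T) (g₀ : G) (μ₁ : LieDual E G)
    {g : ℝ → G} {μ : ℝ → LieDual E G} (hg : ContMDiffOn 𝓘(ℝ, ℝ) 𝓘(ℝ, E) ∞ g (Icc 0 T))
    (hμ : ContDiffOn ℝ ∞ μ (Icc 0 T)) :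
    TrivializedDAlembertPrinciple (trivializedHamiltonian H) T g₀ μ₁ g μ ↔
      LiePoissonEquations (trivializedHamiltonian H) T g₀ μ₁ g μ := by
  have hres (t) (ht : t ∈ Icc 0 T) := eulerResidual_eq_zero_iff (h := trivializedHamiltonian H)
    (g := g) hT ht ((hμ t ht).differentiableWithinAt (by simp))
  have hT' : T ∈ Icc 0 T := ⟨hT.le, le_rfl⟩
  constructor
  · rintro ⟨hg0, hμT, hvar⟩
    have key (η : E) (ν : LieDual E G) : ∀ t ∈ Icc 0 T,
        eulerResidual (trivializedHamiltonian H) T g μ t η ν = 0 := by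
      refine eqOn_zero_of_integral_mul_eq_zero hT ?_ fun χ hχ hs => ?_
      -- Continuity of the residual for constant `(η, ν)` comes from the profile `χ = 1`; this
      -- variation is not fed to the principle, so it may violate the endpoint conditions.
      · obtain ⟨gv, μv, hgv, hμv, ⟨r, hr, hgs, hμs⟩, hd⟩ :=
          exists_variation hT hg hμ (χ := fun _ => 1) contDiff_const η ν
        have h1 := continuousOn_eulerResidual hH hr hT hgs hμs
        simpa only [hgv, hμv, hd, one_smul] using h1
      · obtain ⟨gv, μv, hgv, hμv, ⟨r, hr, hgs, hμs⟩, hd⟩ := exists_variation hT hg hμ hχ η ν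
        -- A profile supported in the open interval vanishes at both ends, so the variation is
        -- admissible. The principle then forces the integral of the residual to vanish.
        have hχ0 : χ 0 = 0 := image_eq_zero_of_notMem_tsupport fun h => lt_irrefl _ (hs h).1
        have hχT : χ T = 0 := image_eq_zero_of_notMem_tsupport fun h => lt_irrefl _ (hs h).2
        have hη0 : χ 0 • η = 0 := by rw [hχ0, zero_smul]
        have h1 := hasDerivAt_trivializedAction hH hr hT hgs hμs
        have h2 := hvar gv μv ⟨⟨r, hr, hgs.prodMk hμs.contMDiffOn⟩, fun t _ => by simp [hgv, hμv]⟩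
          ((hd 0).1.trans hη0) ((hd T).2.trans (by rw [hχT, zero_smul]))
        have h3 := h1.unique h2
        have e0 : μ 0 (trivializedVariation (E := E) gv 0) = 0 := by
          have : (trivializedVariation (E := E) gv 0 : E) = 0 := (hd 0).1.trans hη0
          exact (congrArg (μ 0) this).trans (map_zero _)
        simp only [hgv, hμv] at h3
        rw [e0, sub_zero, add_eq_left] at h3
        refine Eq.trans ?_ h3
        refine intervalIntegral.integral_congr fun t _ => ?_
        rw [(hd t).1, (hd t).2, eulerResidual_smul]
    exact ⟨fun t ht => ((hres t ht).1 fun η ν => key η ν t ht).1,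
      fun t ht => ((hres t ht).1 fun η ν => key η ν t ht).2, hg0, hμT⟩
  · rintro ⟨h1, h2, hg0, hμT⟩
    refine ⟨hg0, hμT, ?_⟩
    rintro gv μv ⟨⟨r, hr, hs⟩, hbase⟩ hη0 -
    have hgs : ContMDiffOn 𝓘(ℝ, ℝ × ℝ) 𝓘(ℝ, E) ∞ (fun x : ℝ × ℝ => gv x.1 x.2) (strip r T) :=
      contMDiff_fst.comp_contMDiffOn hs
    have hμs : ContDiffOn ℝ ∞ (fun x : ℝ × ℝ => μv x.1 x.2) (strip r T) :=
      (contMDiff_snd.comp_contMDiffOn hs).contDiffOn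
    have h3 := hasDerivAt_trivializedAction hH hr hT hgs hμs
    have h4 : ∫ t in (0 : ℝ)..T, eulerResidual (trivializedHamiltonian H) T (gv 0) (μv 0) t
        (trivializedVariation (E := E) gv t) (deriv (fun e => μv e t) 0) = 0 := by
      refine (intervalIntegral.integral_congr fun t ht => ?_).trans intervalIntegral.integral_zero
      rw [uIcc_of_le hT.le] at ht
      exact (eulerResidual_congr _ (fun t ht => (hbase t ht).1) (fun t ht => (hbase t ht).2) ht
        _ _).trans ((hres t ht).2 ⟨h1 t ht, h2 t ht⟩ _ _)
    have e0 : μv 0 0 (trivializedVariation (E := E) gv 0) = 0 :=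
      (congrArg (μv 0 0) hη0).trans (map_zero _)
    rw [h4, e0, add_zero, sub_zero, (hbase T hT').2] at h3
    exact h3

end EulerLagrange

/-! ### Equivalence of the principles on `T*G` and on `G × 𝔤*`. -/

section Trivialization

variable {E : Type*} [NormedAddCommGroup E] [NormedSpace ℝ E]
  {G : Type*} [TopologicalSpace G] [ChartedSpace E G] [Group G] [LieGroup 𝓘(ℝ, E) ∞ G]

theorem apply_eq_momentum (q : CotangentBundle E G) (v : TangentSpace 𝓘(ℝ, E) q.1) :
    q.2 v = momentum q (translateInv q.1 v) :=
  congrArg q.2 (leftDeriv_leftDerivInv (E := E) q.1 v).symm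

theorem action_eq_trivializedAction (H : CotangentBundle E G → ℝ) (T : ℝ)
    (γ : ℝ → CotangentBundle E G) :
    action H T γ = trivializedAction (trivializedHamiltonian H) T (fun t => (γ t).1)
      (fun t => momentum (γ t)) := by
  simp only [action, trivializedAction]
  congr 1
  ext t
  rw [apply_eq_momentum, hamiltonian_eq H (γ t)]

/-- The two variations differ by the linear isomorphism `μ ↦ g*⁻¹ · μ`. -/
theorem momentumVariation_eq_zero_iff (Γ : ℝ → ℝ → CotangentBundle E G) (t : ℝ) :
    momentumVariation Γ t = 0 ↔ deriv (fun e => momentum (Γ e t)) 0 = 0 := by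
  constructor
  · intro h
    have h1 := congrArg (cotranslate (Γ 0 t).1) h
    rw [momentumVariation, cotranslate_cotranslateInv] at h1
    rw [h1]
    ext v
    rfl
  · intro h
    rw [momentumVariation, h]
    exact ContinuousLinearMap.ext fun v => rfl

theorem trivializedVariation_eq_zero_iff (g : ℝ → ℝ → G) (t : ℝ) :
    trivializedVariation (E := E) g t = 0 ↔ positionVariation (E := E) g t = 0 := by
  constructor
  · intro h
    exact (leftDeriv_leftDerivInv (E := E) (g 0 t) _).symm.trans
      ((congrArg (leftDeriv (E := E) (g 0 t)) h).trans (map_zero _))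
  · intro h
    exact (congrArg (leftDerivInv (E := E) (g 0 t)) h).trans (map_zero _)

variable [FiniteDimensional ℝ E]

omit [FiniteDimensional ℝ E] in
theorem IsVariation.trivialize {T : ℝ} {γ : ℝ → CotangentBundle E G}
    {Γ : ℝ → ℝ → CotangentBundle E G} (h : IsVariation T γ Γ) : IsTrivializedVariation T (fun t => (γ t).1) (fun t => momentum (γ t))
      (fun e t => (Γ e t).1) (fun e t => momentum (Γ e t)) := by
  obtain ⟨⟨r, hr, hs⟩, h0⟩ := h
  refine ⟨⟨r, hr, fun z hz => ?_⟩, fun t ht => by simp [h0 t ht]⟩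
  exact (contMDiffWithinAt_fst (hs z hz)).prodMk
      (contMDiffWithinAt_momentum (hs z hz)).contMDiffWithinAt

theorem IsTrivializedVariation.untrivialize {T : ℝ} {γ : ℝ → CotangentBundle E G}
    {gv : ℝ → ℝ → G} {μv : ℝ → ℝ → LieDual E G}
    (h : IsTrivializedVariation T (fun t => (γ t).1) (fun t => momentum (γ t)) gv μv) :
    IsVariation T γ (fun e t => ofMomentum (gv e t) (μv e t)) := by
  have := FiniteDimensional.complete ℝ E
  obtain ⟨⟨r, hr, hs⟩, h0⟩ := h
  refine ⟨⟨r, hr, fun z hz => ?_⟩, fun t ht => ?_⟩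
  · exact contMDiffWithinAt_ofMomentum (contMDiff_fst.contMDiffAt.comp_contMDiffWithinAt z
      (hs z hz))
      (contMDiff_snd.contMDiffAt.comp_contMDiffWithinAt z (hs z hz)).contDiffWithinAt
  · simp only [h0 t ht, ofMomentum_momentum]

/-- Variations correspond through `IsVariation.trivialize` and
`IsTrivializedVariation.untrivialize`, with equal actions along them, and `⟨p(T), δg(T)⟩ = ⟨μ(T),
η(T)⟩`. -/
theorem dAlembert_iff_trivialized (H : CotangentBundle E G → ℝ) {T : ℝ} (hT : 0 < T) (g₀ : G)
    (μ₁ : LieDual E G) (γ : ℝ → CotangentBundle E G) :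
    DAlembertPrinciple H T g₀ μ₁ γ ↔
      TrivializedDAlembertPrinciple (trivializedHamiltonian H) T g₀ μ₁ (fun t => (γ t).1)
        (fun t => momentum (γ t)) := by
  have hT' : T ∈ Icc 0 T := ⟨hT.le, le_rfl⟩
  refine and_congr_right fun _ => and_congr (endpoint_iff _ _) ⟨fun h gv μv hv hη hμ => ?_,
    fun h Γ hv hη hμ => ?_⟩
  · have h1 := h _ hv.untrivialize ((trivializedVariation_eq_zero_iff gv 0).1 hη)
      ((momentumVariation_eq_zero_iff _ T).2 (by simpa only [momentum_ofMomentum] using hμ))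
    simp only [action_eq_trivializedAction, momentum_ofMomentum] at h1
    convert! h1 using 1
    rw [apply_eq_momentum, momentum_ofMomentum, (hv.2 T hT').2]
    rfl
  · have h1 := h _ _ hv.trivialize ((trivializedVariation_eq_zero_iff _ 0).2 hη)
      ((momentumVariation_eq_zero_iff _ T).1 hμ)
    simp only [action_eq_trivializedAction]
    convert! h1 using 1
    exact (apply_eq_momentum (Γ 0 T) _).trans (congrArg (fun q : CotangentBundle E G =>
      momentum q (trivializedVariation (E := E) (fun e t => (Γ e t).1) T : E)) (hv.2 T hT'))

end Trivialization

end TypeII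

end

theorem theorem1 {E : Type*} [NormedAddCommGroup E] [NormedSpace ℝ E] [FiniteDimensional ℝ E]
    {G : Type*} [TopologicalSpace G] [ChartedSpace E G] [Group G] [LieGroup 𝓘(ℝ, E) ∞ G]
    (H : TypeII.CotangentBundle E G → ℝ)
    (hH : ContMDiff (𝓘(ℝ, E).prod 𝓘(ℝ, E →L[ℝ] ℝ)) 𝓘(ℝ, ℝ) ∞ H)
    (T : ℝ) (hT : 0 < T) (g₀ : G) (μ₁ : TypeII.LieDual E G)
    (γ : ℝ → TypeII.CotangentBundle E G)
    (hγ : ContMDiffOn 𝓘(ℝ, ℝ) (𝓘(ℝ, E).prod 𝓘(ℝ, E →L[ℝ] ℝ)) ∞ γ (Icc 0 T)) :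
    List.TFAE [
      TypeII.DAlembertPrinciple H T g₀ μ₁ γ,
      TypeII.HamiltonEquations H T g₀ μ₁ γ,
      TypeII.TrivializedDAlembertPrinciple (TypeII.trivializedHamiltonian H) T g₀ μ₁
        (fun t => (γ t).1) (fun t => TypeII.momentum (γ t)),
      TypeII.LiePoissonEquations (TypeII.trivializedHamiltonian H) T g₀ μ₁
        (fun t => (γ t).1) (fun t => TypeII.momentum (γ t))] := by
  tfae_have 1 ↔ 3 := TypeII.dAlembert_iff_trivialized H hT g₀ μ₁ γ
  tfae_have 2 ↔ 4 := TypeII.hamiltonEquations_iff_liePoissonEquations hH hT g₀ μ₁ hγ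
  tfae_have 3 ↔ 4 := TypeII.trivializedDAlembert_iff_liePoisson hH hT g₀ μ₁
    (fun t ht => TypeII.contMDiffWithinAt_fst (hγ t ht))
    (fun t ht => TypeII.contMDiffWithinAt_momentum (hγ t ht))
  tfae_finish
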